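/- For $n\ge 0$ let $B_n$ be the hyperoctahedral group, i.e. the group of permutations $w$ of $\{\pm1,\dots,\pm n\}$ with $w(-i)=-w(i)$ for all $i$. For $a_1,\dots,a_k\in\{\pm1,\dots,\pm n\}$ ($k\ge 1$) with pairwise distinct absolute values, write $((a_1,\dots,a_k))$ for the permutation $(a_1\,\cdots\,a_k)(-a_1\,\cdots\,-a_k)$, called a paired $k$-cycle, and $[a_1,\dots,a_k]$ for the cycle $(a_1\,\cdots\,a_k\,-a_1\,\cdots\,-a_k)$, called a balanced $k$-cycle; every $w\in B_n$ is a product of disjoint paired and balanced cycles, called the cycles of $w$. The set of reflections of $B_n$ is $\mathcal T=\{[i] : 1\le i\le n\}\cup\{((i,j)),((i,-j)) : 1\le i<j\le n\}$, the absolute length $\ell_{\mathcal T}(w)$ is the least $k$ such that $w$ is a product of $k$ elements of $\mathcal T$, and $\mathrm{Abs}(B_n)$ is the set $B_n$ partially ordered by $$u\preceq v \iff \ell_{\mathcal T}(u)+\ell_{\mathcal T}(u^{-1}v)=\ell_{\mathcal T}(v).$$ For $w\in B_n$ let $\mu(w)$ be the integer partition whose parts are the absolute lengths of the balanced cycles of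 $w$. **Theorem.** For every $w\in B_n$, the closed interval $[e,w]$ in $\mathrm{Abs}(B_n)$, where $e$ is the identity, is a lattice if and only if $\mu(w)$ is either the empty partition (that is, $w$ has no balanced cycles) or a hook partition $(k,1^r)=(k,1,\dots,1)$ with $k\ge 1$ and $r\ge 0$ parts equal to $1$ after the first. -/

import Mathlib

namespace AbsOrder

/-! ### Absolute length with respect to a generating set -/

section AbsLength

/-- The absolute length of `w` with respect to a set `T` of reflections: the smallest `k` such that
`w` is a product of `k` elements of `T`. -/
noncomputable def absLength {W : Type*} [Group W] (T : Set W) (w : W) : ℕ :=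
  sInf {k : ℕ | ∃ l : List W, (∀ t ∈ l, t ∈ T) ∧ l.length = k ∧ l.prod = w}

variable {W : Type*} [Group W] {T : Set W}

theorem absLength_one : absLength T (1 : W) = 0 :=
  Nat.eq_zero_of_le_zero (Nat.sInf_le ⟨[], by simp⟩)

theorem exists_list_absLength (hT : ∀ w : W, ∃ l : List W, (∀ t ∈ l, t ∈ T) ∧ l.prod = w) (w : W) :
    ∃ l : List W, (∀ t ∈ l, t ∈ T) ∧ l.length = absLength T w ∧ l.prod = w := by
  obtain ⟨l, h1, h2⟩ := hT w
  exact Nat.sInf_mem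
    (s := {k : ℕ | ∃ l : List W, (∀ t ∈ l, t ∈ T) ∧ l.length = k ∧ l.prod = w})
    ⟨l.length, l, h1, rfl, h2⟩

theorem absLength_mul_le (hT : ∀ w : W, ∃ l : List W, (∀ t ∈ l, t ∈ T) ∧ l.prod = w) (u v : W) :
    absLength T (u * v) ≤ absLength T u + absLength T v := by
  obtain ⟨l, h1, h2, h3⟩ := exists_list_absLength hT u
  obtain ⟨m, g1, g2, g3⟩ := exists_list_absLength hT v
  refine Nat.sInf_le ⟨l ++ m, ?_, by simp [h2, g2], by simp [h3, g3]⟩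
  intro t ht
  rcases List.mem_append.1 ht with h | h
  · exact h1 t h
  · exact g1 t h

theorem eq_one_of_absLength (hT : ∀ w : W, ∃ l : List W, (∀ t ∈ l, t ∈ T) ∧ l.prod = w) {w : W}
    (hw : absLength T w = 0) : w = 1 := by
  obtain ⟨l, _, h2, h3⟩ := exists_list_absLength hT w
  rw [hw, List.length_eq_zero_iff] at h2
  simpa [h2] using h3.symm

/-- The absolute order on a group generated by `T`:
`u ≼ v` if and only if `ℓ(u) + ℓ(u⁻¹ v) = ℓ(v)`. -/
@[reducible] noncomputable def absPartialOrder (T : Set W)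
    (hT : ∀ w : W, ∃ l : List W, (∀ t ∈ l, t ∈ T) ∧ l.prod = w) : PartialOrder W where
  le u v := absLength T u + absLength T (u⁻¹ * v) = absLength T v
  le_refl u := by simp [absLength_one]
  le_trans u v w huv hvw := by
    have h1 := absLength_mul_le hT (u⁻¹ * v) (v⁻¹ * w)
    have h2 := absLength_mul_le hT u (u⁻¹ * w)
    simp only [mul_assoc, mul_inv_cancel_left] at h1 h2
    omega
  le_antisymm u v huv hvu := by
    have h : absLength T (u⁻¹ * v) = 0 := by omega
    exact (inv_mul_eq_one.1 (eq_one_of_absLength hT h))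

end AbsLength

/-! ### The hyperoctahedral group -/

/-- The set `{±1, …, ±n}`: the pair `(i, ε)` stands for the element `ε (i + 1)`. -/
abbrev SignedIdx (n : ℕ) : Type := Fin n × ℤˣ

/-- The sign change `a ↦ -a` on `{±1, …, ±n}`. -/
def opp {n : ℕ} (a : SignedIdx n) : SignedIdx n := (a.1, -a.2)

theorem opp_opp {n : ℕ} (a : SignedIdx n) : opp (opp a) = a := by simp [opp]

/-- The hyperoctahedral group `B_n`: the permutations `w` of `{±1, …, ±n}` with
`w (-a) = - w a`. -/
def B (n : ℕ) : Subgroup (Equiv.Perm (SignedIdx n)) where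
  carrier := {w | ∀ a, w (opp a) = opp (w a)}
  mul_mem' := by
    intro u v hu hv a
    simp only [Set.mem_ofPred_eq] at hu hv
    simp [hu, hv]
  one_mem' := by intro a; simp
  inv_mem' := by
    intro u hu a
    simp only [Set.mem_ofPred_eq] at hu
    rw [Equiv.Perm.inv_eq_iff_eq, hu]
    simp

/-- The permutation `(a₁ a₂ ⋯ a_k)(-a₁ -a₂ ⋯ -a_k)`, a paired `k`-cycle when the `a_i` have
pairwise distinct absolute values. -/
def pairedCycle {n : ℕ} (l : List (SignedIdx n)) : Equiv.Perm (SignedIdx n) :=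
  l.formPerm * (l.map opp).formPerm

/-- The permutation `(a₁ a₂ ⋯ a_k -a₁ -a₂ ⋯ -a_k)`, a balanced `k`-cycle when `k ≥ 1` and the `a_i`
have pairwise distinct absolute values. -/
def balancedCycle {n : ℕ} (l : List (SignedIdx n)) : Equiv.Perm (SignedIdx n) :=
  (l ++ l.map opp).formPerm

/-- The reflections of `B_n`: the balanced `1`-cycles `[i]`, and the paired `2`-cycles `((i, j))`
and `((i, -j))` with `i < j`. -/
def reflections (n : ℕ) : Set (B n) :=
  {t | (∃ i : Fin n, (t : Equiv.Perm (SignedIdx n)) = balancedCycle [(i, 1)]) ∨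
    ∃ i j : Fin n, i < j ∧
      ((t : Equiv.Perm (SignedIdx n)) = pairedCycle [(i, 1), (j, 1)] ∨
        (t : Equiv.Perm (SignedIdx n)) = pairedCycle [(i, 1), (j, -1)])}

theorem exists_balanced_reflection {n : ℕ} (x : SignedIdx n) :
    ∃ t ∈ reflections n, (t : Equiv.Perm (SignedIdx n)) = Equiv.swap x (opp x) := by
  have key : ∀ a, Equiv.swap x (opp x) (opp a) = opp (Equiv.swap x (opp x) a) := by
    intro a
    simp only [Equiv.swap_apply_def]
    have h1 : opp a = x ↔ a = opp x := ⟨fun h => by rw [← h, opp_opp], fun h => by rw [h, opp_opp]⟩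
    have h2 : opp a = opp x ↔ a = x :=
      ⟨fun h => by rw [← opp_opp a, h, opp_opp], fun h => by rw [h]⟩
    simp only [h1, h2]
    split_ifs <;> simp_all [opp_opp]
  refine ⟨⟨Equiv.swap x (opp x), key⟩, Or.inl ⟨x.1, ?_⟩, rfl⟩
  obtain ⟨i, e⟩ := x
  rcases Int.units_eq_one_or e with rfl | rfl
  · simp [balancedCycle, opp]
  · simp [balancedCycle, opp, Equiv.swap_comm]

theorem exists_paired_reflection {n : ℕ} (x y : SignedIdx n) (hxy : x.1 ≠ y.1) :
    ∃ t ∈ reflections n, (t : Equiv.Perm (SignedIdx n)) =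
      Equiv.swap x y * Equiv.swap (opp x) (opp y) := by
  have hinj : Function.Injective (opp : SignedIdx n → SignedIdx n) := fun a b h => by
    rw [← opp_opp a, h, opp_opp]
  have conj : ∀ a b c : SignedIdx n,
      opp (Equiv.swap a b c) = Equiv.swap (opp a) (opp b) (opp c) := fun a b c =>
    hinj.map_swap a b c
  have hne : ∀ a b : SignedIdx n, a.1 ≠ b.1 → a ≠ b := fun a b h h' => h (by rw [h'])
  have hopp : ∀ a : SignedIdx n, a ≠ opp a := by
    rintro ⟨i, e⟩ h
    rcases Int.units_eq_one_or e with rfl | rfl <;> simp [opp] at h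
  have hcomm : Equiv.swap x y * Equiv.swap (opp x) (opp y) =
      Equiv.swap (opp x) (opp y) * Equiv.swap x y := by
    apply Equiv.Perm.Disjoint.commute
    rw [Equiv.Perm.disjoint_iff_disjoint_support,
      Equiv.Perm.support_swap (hne _ _ hxy), Equiv.Perm.support_swap (hne _ _ (by simpa [opp]))]
    have h1 := hopp x
    have h2 := hopp y
    have h3 : x ≠ opp y := hne _ _ (by simpa [opp])
    have h4 : y ≠ opp x := hne _ _ (by simpa [opp] using hxy.symm)
    simp [h1.symm, h2.symm, h3.symm, h4.symm]
  have key : Equiv.swap x y * Equiv.swap (opp x) (opp y) ∈ B n := by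
    intro a
    have h := DFunLike.congr_fun hcomm (opp a)
    rw [h, Equiv.Perm.mul_apply, Equiv.Perm.mul_apply, conj, conj, opp_opp, opp_opp]
  refine ⟨⟨_, key⟩, Or.inr ?_, rfl⟩
  obtain ⟨i, e⟩ := x
  obtain ⟨j, f⟩ := y
  simp only [opp] at hcomm hxy ⊢
  rcases lt_or_gt_of_ne hxy with h | h
  · refine ⟨i, j, h, ?_⟩
    rcases Int.units_eq_one_or e with rfl | rfl <;> rcases Int.units_eq_one_or f with rfl | rfl
    · left; simp [pairedCycle, opp]
    · right; simp [pairedCycle, opp]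
    · right; rw [hcomm]; simp [pairedCycle, opp]
    · left; rw [hcomm]; simp [pairedCycle, opp]
  · refine ⟨j, i, h, ?_⟩
    rw [Equiv.swap_comm (i, e), Equiv.swap_comm (i, -e)] at hcomm ⊢
    rcases Int.units_eq_one_or e with rfl | rfl <;> rcases Int.units_eq_one_or f with rfl | rfl
    · left; simp [pairedCycle, opp]
    · right; rw [hcomm]; simp [pairedCycle, opp]
    · right; simp [pairedCycle, opp]
    · left; rw [hcomm]; simp [pairedCycle, opp]

/-- The reflections generate `B_n`. -/
theorem exists_list_reflections (n : ℕ) (w : B n) :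
    ∃ l : List (B n), (∀ t ∈ l, t ∈ reflections n) ∧ l.prod = w := by
  induction hk : (w : Equiv.Perm (SignedIdx n)).support.card using Nat.strong_induction_on
    generalizing w with
  | _ k ih =>
    by_cases hw : w = 1
    · exact ⟨[], by simp [hw]⟩
    obtain ⟨x, hx⟩ : ∃ x, (w : Equiv.Perm (SignedIdx n)) x ≠ x := by
      by_contra! h
      exact hw (Subtype.ext (Equiv.ext h))
    have hB : ∀ a, (w : Equiv.Perm (SignedIdx n)) (opp a) =
        opp ((w : Equiv.Perm (SignedIdx n)) a) := w.2
    have hinj : Function.Injective (opp : SignedIdx n → SignedIdx n) := fun a b h => by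
      rw [← opp_opp a, h, opp_opp]
    set y := (w : Equiv.Perm (SignedIdx n)) x with hy
    have hyy : (w : Equiv.Perm (SignedIdx n)) y ≠ y := fun h =>
      hx ((w : Equiv.Perm (SignedIdx n)).injective h)
    have fix : ∀ z, (w : Equiv.Perm (SignedIdx n)) z = z →
        z ≠ x ∧ z ≠ y ∧ z ≠ opp x ∧ z ≠ opp y := by
      intro z hz
      refine ⟨?_, ?_, ?_, ?_⟩ <;> rintro rfl
      · exact hx hz
      · exact hyy hz
      · exact hx (hinj (by rw [← hB]; exact hz))
      · exact hyy (hinj (by rw [← hB]; exact hz))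
    have main : ∃ t ∈ reflections n, t * t = 1 ∧ (t : Equiv.Perm (SignedIdx n)) y = x ∧
        ∀ z, z ≠ x ∧ z ≠ y ∧ z ≠ opp x ∧ z ≠ opp y → (t : Equiv.Perm (SignedIdx n)) z = z := by
      by_cases h : x.1 = y.1
      · have hyx : y = opp x := by
          refine Prod.ext h.symm ?_
          have h2 : y.2 ≠ x.2 := fun h2 => hx (Prod.ext h.symm h2)
          simpa [opp] using Int.units_ne_iff_eq_neg.1 h2
        obtain ⟨t, ht, hte⟩ := exists_balanced_reflection x
        refine ⟨t, ht, Subtype.ext ?_, ?_, ?_⟩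
        · simp [hte]
        · simp [hte, hyx]
        · rintro z ⟨h1, -, h3, -⟩
          rw [hte, Equiv.swap_apply_of_ne_of_ne h1 h3]
      · obtain ⟨t, ht, hte⟩ := exists_paired_reflection x y h
        have e1 : y ≠ opp x := fun h' => h (by rw [h']; rfl)
        have e2 : y ≠ opp y := by
          intro h'
          have := congrArg Prod.snd h'
          rcases Int.units_eq_one_or y.2 with h2 | h2 <;> simp [opp, h2] at this
        have e3 : x ≠ opp y := fun h' => h (by rw [h']; rfl)
        have e4 : x ≠ opp x := by
          intro h'
          have := congrArg Prod.snd h'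
          rcases Int.units_eq_one_or x.2 with h2 | h2 <;> simp [opp, h2] at this
        have hty : (t : Equiv.Perm (SignedIdx n)) y = x := by
          rw [hte, Equiv.Perm.mul_apply, Equiv.swap_apply_of_ne_of_ne e1 e2,
            Equiv.swap_apply_right]
        have htx : (t : Equiv.Perm (SignedIdx n)) x = y := by
          rw [hte, Equiv.Perm.mul_apply, Equiv.swap_apply_of_ne_of_ne e4 e3,
            Equiv.swap_apply_left]
        have htB : ∀ a, (t : Equiv.Perm (SignedIdx n)) (opp a) =
            opp ((t : Equiv.Perm (SignedIdx n)) a) := t.2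
        have hfix : ∀ z, z ≠ x ∧ z ≠ y ∧ z ≠ opp x ∧ z ≠ opp y →
            (t : Equiv.Perm (SignedIdx n)) z = z := by
          rintro z ⟨h1, h2, h3, h4⟩
          rw [hte, Equiv.Perm.mul_apply, Equiv.swap_apply_of_ne_of_ne h3 h4,
            Equiv.swap_apply_of_ne_of_ne h1 h2]
        refine ⟨t, ht, Subtype.ext (Equiv.ext fun z => ?_), hty, hfix⟩
        rw [Subgroup.coe_mul, Equiv.Perm.mul_apply, Subgroup.coe_one, Equiv.Perm.one_apply]
        by_cases h1 : z = x
        · rw [h1, htx, hty]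
        by_cases h2 : z = y
        · rw [h2, hty, htx]
        by_cases h3 : z = opp x
        · rw [h3, htB, htx, htB, hty]
        by_cases h4 : z = opp y
        · rw [h4, htB, hty, htB, htx]
        rw [hfix z ⟨h1, h2, h3, h4⟩, hfix z ⟨h1, h2, h3, h4⟩]
    obtain ⟨t, ht, htt, hty, htfix⟩ := main
    have hlt : ((t * w : B n) : Equiv.Perm (SignedIdx n)).support.card < k := by
      rw [← hk]
      apply Finset.card_lt_card
      rw [Finset.ssubset_iff_of_subset]
      · refine ⟨x, by simpa using hx, ?_⟩
        rw [Equiv.Perm.mem_support, not_not, Subgroup.coe_mul, Equiv.Perm.mul_apply]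
        exact hty
      · intro z hz
        rw [Equiv.Perm.mem_support] at hz ⊢
        intro hz'
        apply hz
        rw [Subgroup.coe_mul, Equiv.Perm.mul_apply, hz']
        exact htfix z (fix z hz')
    obtain ⟨l, hl, hp⟩ := ih _ hlt (t * w) rfl
    refine ⟨t :: l, ?_, ?_⟩
    · intro s hs
      rcases List.mem_cons.1 hs with rfl | h
      · exact ht
      · exact hl s h
    · rw [List.prod_cons, hp, ← mul_assoc, htt, one_mul]

/-- The poset `Abs(B_n)`: the group `B_n` with its absolute order. -/
noncomputable instance instPartialOrderB (n : ℕ) : PartialOrder (B n) :=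
  absPartialOrder (reflections n) (exists_list_reflections n)

/-- A poset is a lattice if any two elements have a least upper bound and a greatest lower bound. -/
def IsLatticePoset (P : Type*) [PartialOrder P] : Prop :=
  ∀ a b : P, (∃ c, IsLUB {a, b} c) ∧ (∃ c, IsGLB {a, b} c)

/-! ### Balanced cycles and the associated partition -/

/-- `c` is a balanced cycle `[a₁, …, a_k]`, with `k ≥ 1` and pairwise distinct `|a_i|`. -/
def IsBalancedCycle {n : ℕ} (c : Equiv.Perm (SignedIdx n)) : Prop :=
  ∃ l : List (SignedIdx n), l ≠ [] ∧ (l.map Prod.fst).Nodup ∧ c = balancedCycle l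

open Classical in
/-- The balanced cycles of `w`: the balanced cycles among the disjoint cycles of `w`. -/
noncomputable def balancedCycles {n : ℕ} (w : B n) : Finset (B n) :=
  {c : B n | IsBalancedCycle (c : Equiv.Perm (SignedIdx n)) ∧
    (c : Equiv.Perm (SignedIdx n)) ∈ (w : Equiv.Perm (SignedIdx n)).cycleFactorsFinset}

/-- The partition `μ(w)`, whose parts are the absolute lengths of the balanced cycles of `w`. -/
noncomputable def mu {n : ℕ} (w : B n) :
    Nat.Partition ((balancedCycles w).val.map (absLength (reflections n))).sum where
  parts := (balancedCycles w).val.map (absLength (reflections n))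
  parts_pos := by
    intro i hi
    obtain ⟨c, hc, rfl⟩ := Multiset.mem_map.1 hi
    refine Nat.pos_of_ne_zero fun h => ?_
    have h1 : c = 1 := eq_one_of_absLength (exists_list_reflections n) h
    have h2 : (c : Equiv.Perm (SignedIdx n)) ∈
        (w : Equiv.Perm (SignedIdx n)).cycleFactorsFinset := by
      have h3 := Finset.mem_def.2 hc
      simp only [balancedCycles, Finset.mem_filter] at h3
      exact h3.2.2
    rw [h1] at h2
    exact (Equiv.Perm.mem_cycleFactorsFinset_iff.1 h2).1.ne_one rfl
  parts_sum := rfl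

/-- A hook partition: one of the form `(k, 1, …, 1) = (k, 1^r)` with `k ≥ 1` and `r ≥ 0`. -/
def IsHook {m : ℕ} (p : Nat.Partition m) : Prop :=
  ∃ k r : ℕ, 1 ≤ k ∧ p.parts = k ::ₘ Multiset.replicate r 1

end AbsOrder

namespace AbsOrder

open Module

/-! ### Orthogonal transformations and their fixed spaces -/

section Orthogonal

variable {V : Type*} [NormedAddCommGroup V] [InnerProductSpace ℝ V]

/-! Let `B n` act on Euclidean space by signed permutation matrices (`rep`). By Carter's formula
`absLength_eq_codimFixed`, absolute length is the codimension of the fixed space. An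
orthogonal-geometry argument then shows that, among elements below a common `w`, the absolute order
is reverse inclusion of fixed spaces (`codim_of_fixedSpace_le`, `le_of_fixedSpace_le`). A reflection
lies below `w` exactly when its root is orthogonal to the fixed space of `w`. In terms of cycles,
the two signed indices it exchanges lie on one cycle of `w`, or each lies on a balanced cycle
(`refl_le_iff_sameCycle`).

Both directions pass through one obstruction, `AboveDoubleTwoCycle`: some product `[a, b] [c, d]` of
two disjoint balanced two-cycles lies below `w`. Such a product has two distinct coatoms, the paired
cycles `((a, b, c, d))` and `((a, -d, c, -b))`, which are both above `((a, c))` and `((b, d))`,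
while no element below both coatoms is above both reflections (`IsDoubleTwoCycle.exists_no_join`).
Hence the interval is not a lattice.

Conversely, without the obstruction any two reflections below `w` have a join (`exists_join_refl`).
Erasing the coordinates that neither reflection involves (`exists_restrict`) leaves rank at most
four. There a join can fail only if two coatoms of an element with only balanced cycles are both
above the two reflections, and a finite check in `B 4` shows that this forces the square of the
element to be `-1`, which is the obstruction, or the product of the two reflections to be below it.
Since the interval from `z` to `w` is a translate of the one from `1` to `z⁻¹ * w`, joins of
reflections give joins of covers above every `z`, and these suffice (`exists_isLUB_of_local`).

Finally, erasing coordinates from cycles shows that the obstruction occurs exactly when `w` has two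
distinct balanced cycles of length at least two, which is the negation of the condition on `mu w`.
-/

/-- The fixed space of a linear isometry. -/
def fixedSpace (g : V ≃ₗᵢ[ℝ] V) : Submodule ℝ V where
  carrier := {x | g x = x}
  add_mem' := by
    intro x y hx hy
    simp only [Set.mem_ofPred_eq] at hx hy ⊢
    rw [map_add, hx, hy]
  zero_mem' := by simp
  smul_mem' := by
    intro c x hx
    simp only [Set.mem_ofPred_eq] at hx ⊢
    rw [map_smul, hx]

theorem mem_fixedSpace {g : V ≃ₗᵢ[ℝ] V} {x : V} : x ∈ fixedSpace g ↔ g x = x := Iff.rfl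

theorem fixedSpace_inf_le_mul (g h : V ≃ₗᵢ[ℝ] V) :
    fixedSpace g ⊓ fixedSpace h ≤ fixedSpace (g * h) := by
  rintro x ⟨hg, hh⟩
  change g (h x) = x
  rw [mem_fixedSpace.1 hh, mem_fixedSpace.1 hg]

/-- The linear map `g - 1`. -/
def subOne (g : V ≃ₗᵢ[ℝ] V) : V →ₗ[ℝ] V := g.toLinearEquiv.toLinearMap - LinearMap.id

theorem subOne_apply (g : V ≃ₗᵢ[ℝ] V) (x : V) : subOne g x = g x - x := rfl

theorem ker_subOne (g : V ≃ₗᵢ[ℝ] V) : LinearMap.ker (subOne g) = fixedSpace g := by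
  ext x
  rw [LinearMap.mem_ker, subOne_apply, sub_eq_zero, mem_fixedSpace]

theorem inner_subOne_eq_zero {g : V ≃ₗᵢ[ℝ] V} {x : V} (hx : x ∈ fixedSpace g) (y : V) :
    inner ℝ x (g y - y) = 0 := by
  rw [inner_sub_right, sub_eq_zero]
  conv_lhs => rw [← mem_fixedSpace.1 hx]
  exact g.inner_map_map x y

theorem mem_fixedSpace_inv_mul {u w : V ≃ₗᵢ[ℝ] V} {x : V} :
    x ∈ fixedSpace (u⁻¹ * w) ↔ w x = u x := by
  change u⁻¹ (w x) = x ↔ _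
  constructor
  · intro h
    have := congrArg u h
    simpa using this
  · intro h
    rw [h]
    simp

theorem fixedSpace_reflection (a : V) : fixedSpace (ℝ ∙ a)ᗮ.reflection = (ℝ ∙ a)ᗮ := by
  ext x
  rw [mem_fixedSpace, Submodule.reflection_eq_self_iff]

/-- The codimension of the fixed space. -/
noncomputable def codimFixed (g : V ≃ₗᵢ[ℝ] V) : ℕ := finrank ℝ (fixedSpace g)ᗮ

theorem codimFixed_reflection {a : V} (ha : a ≠ 0) : codimFixed (ℝ ∙ a)ᗮ.reflection = 1 := by
  rw [codimFixed, fixedSpace_reflection, Submodule.orthogonal_orthogonal, finrank_span_singleton ha]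

variable [FiniteDimensional ℝ V]

/-- An isometry moves every vector by something orthogonal to its fixed vectors; rank-nullity turns
this inclusion into equality. -/
theorem range_subOne (g : V ≃ₗᵢ[ℝ] V) : LinearMap.range (subOne g) = (fixedSpace g)ᗮ := by
  apply Submodule.eq_of_le_of_finrank_eq
  · rintro _ ⟨y, rfl⟩
    rw [Submodule.mem_orthogonal]
    intro x hx
    exact inner_subOne_eq_zero hx y
  · have h1 := LinearMap.finrank_range_add_finrank_ker (subOne g)
    have h2 := (fixedSpace g).finrank_add_finrank_orthogonal
    rw [ker_subOne] at h1
    omega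

theorem finrank_fixedSpace_add (g : V ≃ₗᵢ[ℝ] V) :
    finrank ℝ (fixedSpace g) + codimFixed g = finrank ℝ V :=
  (fixedSpace g).finrank_add_finrank_orthogonal

theorem finrank_add_le_inf_add (K L : Submodule ℝ V) :
    finrank ℝ K + finrank ℝ L ≤ finrank ℝ (K ⊓ L : Submodule ℝ V) + finrank ℝ V := by
  have h1 := Submodule.finrank_sup_add_finrank_inf_eq K L
  have h2 := Submodule.finrank_le (K ⊔ L)
  omega

theorem codimFixed_mul_le (g h : V ≃ₗᵢ[ℝ] V) :
    codimFixed (g * h) ≤ codimFixed g + codimFixed h := by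
  have h1 := finrank_add_le_inf_add (fixedSpace g) (fixedSpace h)
  have h2 := Submodule.finrank_mono (fixedSpace_inf_le_mul g h)
  have h3 := finrank_fixedSpace_add g
  have h4 := finrank_fixedSpace_add h
  have h5 := finrank_fixedSpace_add (g * h)
  omega

/-- If the codimensions of fixed spaces add up, then the fixed space of the product is contained in
the fixed space of the factors. -/
theorem fixedSpace_le_of_codim {u w : V ≃ₗᵢ[ℝ] V}
    (h : codimFixed u + codimFixed (u⁻¹ * w) = codimFixed w) : fixedSpace w ≤ fixedSpace u := by
  have h0 : fixedSpace u ⊓ fixedSpace (u⁻¹ * w) ≤ fixedSpace w := by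
    simpa using fixedSpace_inf_le_mul u (u⁻¹ * w)
  have h1 := finrank_add_le_inf_add (fixedSpace u) (fixedSpace (u⁻¹ * w))
  have h3 := finrank_fixedSpace_add u
  have h4 := finrank_fixedSpace_add (u⁻¹ * w)
  have h5 := finrank_fixedSpace_add w
  rw [← Submodule.eq_of_le_of_finrank_le h0 (by omega)]
  exact inf_le_left

/-- If `u⁻¹ * w` fixes `x`, then `w x - x = u x - x` is orthogonal to the fixed space of `u`;
additivity of codimensions makes the dimensions agree. Thus `w` and the fixed space of `u` determine
that of the complement, which is why fixed spaces control the order below `w`. -/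
theorem fixedSpace_inv_mul_eq_comap {u w : V ≃ₗᵢ[ℝ] V}
    (h : codimFixed u + codimFixed (u⁻¹ * w) = codimFixed w) :
    fixedSpace (u⁻¹ * w) = (fixedSpace u)ᗮ.comap (subOne w) := by
  apply Submodule.eq_of_le_of_finrank_le
  · intro x hx
    rw [Submodule.mem_comap, subOne_apply, mem_fixedSpace_inv_mul.1 hx, Submodule.mem_orthogonal]
    intro y hy
    exact inner_subOne_eq_zero hy x
  -- Rank-nullity for `w - 1` on the preimage: the range lies in a space of dimension `codimFixed
  -- u`, and the kernel embeds in the fixed space of `w`.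
  · have h1 := LinearMap.finrank_range_add_finrank_ker
      ((subOne w).domRestrict ((fixedSpace u)ᗮ.comap (subOne w)))
    have h2 : finrank ℝ (LinearMap.range
        ((subOne w).domRestrict ((fixedSpace u)ᗮ.comap (subOne w)))) ≤ codimFixed u := by
      apply Submodule.finrank_mono
      rintro _ ⟨⟨x, hx⟩, rfl⟩
      exact hx
    have h3 : finrank ℝ (LinearMap.ker
        ((subOne w).domRestrict ((fixedSpace u)ᗮ.comap (subOne w)))) ≤
        finrank ℝ (fixedSpace w) := by
      rw [LinearMap.ker_domRestrict, ker_subOne w, ← Submodule.finrank_map_subtype_eq]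
      exact Submodule.finrank_mono (Submodule.map_comap_le _ _)
    have h4 := finrank_fixedSpace_add (u⁻¹ * w)
    have h5 := finrank_fixedSpace_add w
    omega

/-- Below a common element `w`, containment of fixed spaces determines the absolute order. -/
theorem codim_of_fixedSpace_le {u v w : V ≃ₗᵢ[ℝ] V}
    (hu : codimFixed u + codimFixed (u⁻¹ * w) = codimFixed w)
    (hv : codimFixed v + codimFixed (v⁻¹ * w) = codimFixed w)
    (huv : fixedSpace v ≤ fixedSpace u) :
    codimFixed u + codimFixed (u⁻¹ * v) = codimFixed v := by
  -- Passing to complements in `w` reverses inclusion of fixed spaces. With `h2` and `h3`, the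
  -- dimension formula then bounds `codimFixed (u⁻¹ * v)` from above.
  have h1 : fixedSpace (u⁻¹ * w) ≤ fixedSpace (v⁻¹ * w) := by
    rw [fixedSpace_inv_mul_eq_comap hu, fixedSpace_inv_mul_eq_comap hv]
    exact Submodule.comap_mono (Submodule.orthogonal_le huv)
  have h2 : fixedSpace (u⁻¹ * w) ⊔ fixedSpace v ≤ fixedSpace (u⁻¹ * v) := by
    apply sup_le
    · intro x hx
      rw [mem_fixedSpace_inv_mul, ← mem_fixedSpace_inv_mul.1 hx,
        mem_fixedSpace_inv_mul.1 (h1 hx)]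
    · intro x hx
      rw [mem_fixedSpace_inv_mul, mem_fixedSpace.1 hx, mem_fixedSpace.1 (huv hx)]
  have h3 : fixedSpace (u⁻¹ * w) ⊓ fixedSpace v ≤ fixedSpace w := by
    rintro x ⟨hx, hx'⟩
    rw [mem_fixedSpace, mem_fixedSpace_inv_mul.1 (h1 hx), mem_fixedSpace.1 hx']
  have h4 := Submodule.finrank_sup_add_finrank_inf_eq (fixedSpace (u⁻¹ * w)) (fixedSpace v)
  have h5 := Submodule.finrank_mono h2
  have h6 := Submodule.finrank_mono h3
  have h7 := finrank_fixedSpace_add (u⁻¹ * w)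
  have h8 := finrank_fixedSpace_add w
  have h9 := finrank_fixedSpace_add v
  have h10 := finrank_fixedSpace_add (u⁻¹ * v)
  have h11 : codimFixed v ≤ codimFixed u + codimFixed (u⁻¹ * v) := by
    simpa using codimFixed_mul_le u (u⁻¹ * v)
  omega

/-- Multiplying by a reflection in a vector orthogonal to the fixed space lowers the codimension. -/
theorem codimFixed_reflection_mul {a : V} (ha : a ≠ 0) {w : V ≃ₗᵢ[ℝ] V}
    (haw : a ∈ (fixedSpace w)ᗮ) :
    codimFixed ((ℝ ∙ a)ᗮ.reflection * w) + 1 = codimFixed w := by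
  have h1 : codimFixed w ≤ 1 + codimFixed ((ℝ ∙ a)ᗮ.reflection * w) := by
    rw [← codimFixed_reflection ha]
    have h := codimFixed_mul_le (ℝ ∙ a)ᗮ.reflection ((ℝ ∙ a)ᗮ.reflection * w)
    rwa [← mul_assoc, Submodule.reflection_mul_reflection, one_mul] at h
  have h2 : fixedSpace w < fixedSpace ((ℝ ∙ a)ᗮ.reflection * w) := by
    rw [SetLike.lt_iff_le_and_exists]
    constructor
    · intro x hx
      change (ℝ ∙ a)ᗮ.reflection (w x) = x
      rw [mem_fixedSpace.1 hx, Submodule.reflection_eq_self_iff,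
        Submodule.mem_orthogonal_singleton_iff_inner_left]
      exact haw x hx
    -- Write `a = w v - v`; the reflection in `a` sends `w v` back to `v`, so `v` is a new fixed
    -- vector.
    · rw [← range_subOne] at haw
      obtain ⟨v, hv⟩ := haw
      rw [subOne_apply] at hv
      refine ⟨v, ?_, fun h => ha ?_⟩
      · change (ℝ ∙ a)ᗮ.reflection (w v) = v
        rw [← hv]
        exact Submodule.reflection_sub (w.norm_map v)
      · rw [← hv, mem_fixedSpace.1 h, sub_self]
  have h3 := Submodule.finrank_lt_finrank_of_lt h2
  have h4 := finrank_fixedSpace_add w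
  have h5 := finrank_fixedSpace_add ((ℝ ∙ a)ᗮ.reflection * w)
  omega

end Orthogonal

/-! ### The geometric representation of the hyperoctahedral group -/

section Representation

variable {n : ℕ}

theorem opp_injective : Function.Injective (opp : SignedIdx n → SignedIdx n) := fun a b h => by
  rw [← opp_opp a, h, opp_opp]

theorem opp_ne (x : SignedIdx n) : opp x ≠ x := by
  obtain ⟨i, e⟩ := x
  intro h
  rcases Int.units_eq_one_or e with rfl | rfl <;> simp [opp] at h

theorem opp_eq_iff {x y : SignedIdx n} : opp x = y ↔ x = opp y :=
  ⟨fun h => by rw [← h, opp_opp], fun h => by rw [h, opp_opp]⟩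

theorem fst_opp (x : SignedIdx n) : (opp x).1 = x.1 := rfl

theorem fst_eq_iff {x y : SignedIdx n} : x.1 = y.1 ↔ x = y ∨ x = opp y := by
  constructor
  · intro h
    by_cases h2 : x.2 = y.2
    · exact Or.inl (Prod.ext h h2)
    · exact Or.inr (Prod.ext h (Int.units_ne_iff_eq_neg.1 h2))
  · rintro (rfl | rfl) <;> rfl

theorem apply_opp (w : B n) (x : SignedIdx n) : w.1 (opp x) = opp (w.1 x) := w.2 x

theorem ext_apply {u v : B n} (h : ∀ x, u.1 x = v.1 x) : u = v := Subtype.ext (Equiv.ext h)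

theorem mul_apply (u v : B n) (x : SignedIdx n) : (u * v).1 x = u.1 (v.1 x) := rfl

theorem inv_apply_apply (u : B n) (x : SignedIdx n) : (u⁻¹).1 (u.1 x) = x := by
  rw [← mul_apply, inv_mul_cancel]
  rfl

theorem apply_inv_apply (u : B n) (x : SignedIdx n) : u.1 ((u⁻¹).1 x) = x := by
  rw [← mul_apply, mul_inv_cancel]
  rfl

/-- The coordinate of a vector along a signed basis vector. -/
noncomputable def coord (x : SignedIdx n) (f : EuclideanSpace ℝ (Fin n)) : ℝ :=
  ((x.2 : ℤ) : ℝ) * f x.1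

/-- The signed basis vector attached to an element of `{±1, …, ±n}`. -/
noncomputable def vec (x : SignedIdx n) : EuclideanSpace ℝ (Fin n) :=
  EuclideanSpace.single x.1 ((x.2 : ℤ) : ℝ)

theorem inner_vec (x : SignedIdx n) (f : EuclideanSpace ℝ (Fin n)) :
    inner ℝ (vec x) f = coord x f := by
  simp [vec, coord, EuclideanSpace.inner_single_left]

theorem coord_add (x : SignedIdx n) (f g : EuclideanSpace ℝ (Fin n)) :
    coord x (f + g) = coord x f + coord x g := by
  simp [coord, mul_add]

theorem coord_smul (x : SignedIdx n) (c : ℝ) (f : EuclideanSpace ℝ (Fin n)) :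
    coord x (c • f) = c * coord x f := by
  simp [coord, mul_left_comm]

theorem coord_opp (x : SignedIdx n) (f : EuclideanSpace ℝ (Fin n)) :
    coord (opp x) f = - coord x f := by
  simp [coord, opp]

theorem coord_one (i : Fin n) (f : EuclideanSpace ℝ (Fin n)) : coord (i, 1) f = f i := by
  simp [coord]

theorem eq_of_coord {f g : EuclideanSpace ℝ (Fin n)} (h : ∀ x, coord x f = coord x g) : f = g := by
  ext i
  simpa [coord_one] using h (i, 1)

theorem coord_vec_self (x : SignedIdx n) : coord x (vec x) = 1 := by
  obtain ⟨i, e⟩ := x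
  rcases Int.units_eq_one_or e with rfl | rfl <;> simp [coord, vec]

theorem coord_vec_opp (x : SignedIdx n) : coord (opp x) (vec x) = -1 := by
  rw [coord_opp, coord_vec_self]

theorem coord_vec_of_fst_ne {x y : SignedIdx n} (h : x.1 ≠ y.1) : coord x (vec y) = 0 := by
  simp [coord, vec, h]

theorem coord_vec_lt_one {x y : SignedIdx n} (h : x ≠ y) : coord x (vec y) < 1 := by
  by_cases h1 : x.1 = y.1
  · rcases fst_eq_iff.1 h1 with rfl | rfl
    · exact absurd rfl h
    · rw [coord_vec_opp]
      norm_num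
  · rw [coord_vec_of_fst_ne h1]
    exact one_pos

theorem vec_injective : Function.Injective (vec : SignedIdx n → _) := by
  intro x y h
  by_contra hxy
  have := coord_vec_lt_one hxy
  rw [← h, coord_vec_self] at this
  exact lt_irrefl _ this

/-- Summing over signed indices counts each coordinate twice, and makes the norm visibly invariant
because a signed permutation only reindexes the sum. -/
theorem sum_coord_sq (f : EuclideanSpace ℝ (Fin n)) :
    ∑ x : SignedIdx n, coord x f ^ 2 = 2 * ‖f‖ ^ 2 := by
  have h : ∀ x : SignedIdx n, coord x f ^ 2 = f x.1 ^ 2 := by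
    rintro ⟨i, e⟩
    rcases Int.units_eq_one_or e with rfl | rfl <;> simp [coord]
  rw [Finset.sum_congr rfl fun x _ => h x, Fintype.sum_prod_type, EuclideanSpace.norm_sq_eq]
  simp [Finset.mul_sum]

/-- The action of a signed permutation on vectors, as a function. -/
noncomputable def actFun (w : B n) (f : EuclideanSpace ℝ (Fin n)) : EuclideanSpace ℝ (Fin n) :=
  WithLp.toLp 2 fun i => coord ((w⁻¹).1 (i, 1)) f

theorem coord_actFun (w : B n) (x : SignedIdx n) (f : EuclideanSpace ℝ (Fin n)) :
    coord x (actFun w f) = coord ((w⁻¹).1 x) f := by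
  obtain ⟨i, e⟩ := x
  rcases Int.units_eq_one_or e with rfl | rfl
  · rw [coord_one]
    rfl
  · have h : ((i, -1) : SignedIdx n) = opp (i, 1) := rfl
    rw [h, apply_opp, coord_opp, coord_opp, coord_one]
    rfl

/-- The representation of the hyperoctahedral group by signed permutation matrices. -/
noncomputable def rep :
    B n →* (EuclideanSpace ℝ (Fin n) ≃ₗᵢ[ℝ] EuclideanSpace ℝ (Fin n)) where
  toFun w :=
    { toFun := actFun w
      invFun := actFun w⁻¹
      map_add' := fun f g => eq_of_coord fun x => by simp only [coord_actFun, coord_add]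
      map_smul' := fun c f => eq_of_coord fun x => by
        simp only [coord_actFun, coord_smul, RingHom.id_apply]
      left_inv := fun f => eq_of_coord fun x => by
        rw [coord_actFun, coord_actFun, apply_inv_apply]
      right_inv := fun f => eq_of_coord fun x => by
        rw [coord_actFun, coord_actFun, inv_apply_apply]
      norm_map' := fun f => by
        have h : ‖actFun w f‖ ^ 2 = ‖f‖ ^ 2 := by
          have h1 := sum_coord_sq (actFun w f)
          simp only [coord_actFun] at h1
          rw [Equiv.sum_comp ((w⁻¹).1) fun x => coord x f ^ 2, sum_coord_sq] at h1
          linarith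
        exact (sq_eq_sq₀ (norm_nonneg _) (norm_nonneg _)).1 h }
  map_one' := LinearIsometryEquiv.ext fun f => eq_of_coord fun x => by
    change coord x (actFun 1 f) = coord x f
    rw [coord_actFun, inv_one]
    rfl
  map_mul' u v := LinearIsometryEquiv.ext fun f => eq_of_coord fun x => by
    change coord x (actFun (u * v) f) = coord x (actFun u (actFun v f))
    rw [coord_actFun, coord_actFun, coord_actFun, mul_inv_rev]
    rfl

theorem coord_rep (w : B n) (x : SignedIdx n) (f : EuclideanSpace ℝ (Fin n)) :
    coord x (rep w f) = coord ((w⁻¹).1 x) f := coord_actFun w x f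

theorem rep_vec (w : B n) (x : SignedIdx n) : rep w (vec x) = vec (w.1 x) := by
  apply eq_of_coord
  intro y
  rw [coord_rep]
  by_cases h1 : (w⁻¹).1 y = x
  · have h2 : y = w.1 x := by rw [← h1, apply_inv_apply]
    rw [h1, h2, coord_vec_self, coord_vec_self]
  by_cases h2 : (w⁻¹).1 y = opp x
  · have h3 : y = opp (w.1 x) := by rw [← apply_opp, ← h2, apply_inv_apply]
    rw [h2, h3, coord_vec_opp, coord_vec_opp]
  · have h3 : y.1 ≠ (w.1 x).1 := by
      intro h
      rcases fst_eq_iff.1 h with h | h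
      · exact h1 (by rw [h, inv_apply_apply])
      · exact h2 (by rw [h, ← apply_opp, inv_apply_apply])
    rw [coord_vec_of_fst_ne h3, coord_vec_of_fst_ne]
    intro h
    rcases fst_eq_iff.1 h with h | h
    · exact h1 h
    · exact h2 h

theorem mem_fixedSpace_rep {w : B n} {f : EuclideanSpace ℝ (Fin n)} :
    f ∈ fixedSpace (rep w) ↔ ∀ x, coord (w.1 x) f = coord x f := by
  rw [mem_fixedSpace]
  constructor
  · intro h x
    conv_lhs => rw [← h]
    rw [coord_rep, inv_apply_apply]
  · intro h
    apply eq_of_coord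
    intro x
    rw [coord_rep, ← h, apply_inv_apply]

theorem vec_mem_fixedSpace_rep {w : B n} {x : SignedIdx n} :
    vec x ∈ fixedSpace (rep w) ↔ w.1 x = x := by
  rw [mem_fixedSpace, rep_vec, vec_injective.eq_iff]

/-! ### Reflections -/

/-- The function underlying the reflection exchanging `x` and `y`. -/
def reflFun (x y z : SignedIdx n) : SignedIdx n :=
  if z = x then y else if z = y then x else if z = opp x then opp y else
    if z = opp y then opp x else z

theorem reflFun_opp (x y z : SignedIdx n) : reflFun x y (opp z) = opp (reflFun x y z) := by
  have h := @opp_opp n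
  have h1 := @opp_ne n
  unfold reflFun
  grind

theorem reflFun_involutive (x y : SignedIdx n) : Function.Involutive (reflFun x y) := by
  intro z
  have h := @opp_opp n
  have h1 := @opp_ne n
  unfold reflFun
  grind

/-- The reflection exchanging `x` and `y`, which is the identity for `x = y`. -/
def refl (x y : SignedIdx n) : B n := ⟨(reflFun_involutive x y).toPerm, reflFun_opp x y⟩

theorem refl_apply (x y z : SignedIdx n) : (refl x y).1 z =
    if z = x then y else if z = y then x else if z = opp x then opp y else
      if z = opp y then opp x else z := rfl

theorem refl_apply_of_fst_ne {x y z : SignedIdx n} (hx : z.1 ≠ x.1) (hy : z.1 ≠ y.1) :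
    (refl x y).1 z = z := by
  rw [refl_apply, if_neg, if_neg, if_neg, if_neg]
  all_goals
    rintro rfl
    first
    | exact hx rfl
    | exact hy rfl

theorem refl_apply_left (x y : SignedIdx n) : (refl x y).1 x = y := by simp [refl_apply]

theorem refl_apply_right (x y : SignedIdx n) : (refl x y).1 y = x := by
  by_cases h : y = x
  · rw [h, refl_apply_left]
  · rw [refl_apply, if_neg h, if_pos rfl]

theorem refl_mul_self (x y : SignedIdx n) : refl x y * refl x y = 1 :=
  ext_apply fun z => reflFun_involutive x y z

theorem refl_inv (x y : SignedIdx n) : (refl x y)⁻¹ = refl x y :=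
  inv_eq_of_mul_eq_one_left (refl_mul_self x y)

theorem refl_self (x : SignedIdx n) : refl x x = 1 := by
  apply ext_apply
  intro z
  rw [refl_apply]
  change _ = z
  split_ifs <;> simp_all

theorem refl_opp_eq (x : SignedIdx n) : (refl x (opp x)).1 = Equiv.swap x (opp x) := by
  apply Equiv.ext
  intro z
  rw [refl_apply, Equiv.swap_apply_def]
  have h := @opp_opp n
  grind

theorem refl_eq_of_fst_ne {x y : SignedIdx n} (h : x.1 ≠ y.1) :
    (refl x y).1 = Equiv.swap x y * Equiv.swap (opp x) (opp y) := by
  apply Equiv.ext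
  intro z
  have h1 : opp x ≠ y := fun h' => h (by rw [← h']; rfl)
  rw [refl_apply, Equiv.Perm.mul_apply, Equiv.swap_apply_def, Equiv.swap_apply_def]
  have h := @opp_opp n
  have h1 := @opp_ne n
  grind

theorem refl_mem_reflections {x y : SignedIdx n} (h : x ≠ y) : refl x y ∈ reflections n := by
  by_cases h1 : x.1 = y.1
  · rcases fst_eq_iff.1 h1.symm with rfl | rfl
    · exact absurd rfl h
    · obtain ⟨t, ht, h2⟩ := exists_balanced_reflection x
      rwa [← Subtype.ext (h2.trans (refl_opp_eq x).symm)]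
  · obtain ⟨t, ht, h2⟩ := exists_paired_reflection x y h1
    rwa [← Subtype.ext (h2.trans (refl_eq_of_fst_ne h1).symm)]

theorem exists_refl_of_mem_reflections {t : B n} (ht : t ∈ reflections n) :
    ∃ x y : SignedIdx n, x ≠ y ∧ t = refl x y := by
  rcases ht with ⟨i, h⟩ | ⟨i, j, hij, h | h⟩
  · refine ⟨(i, 1), opp (i, 1), (opp_ne _).symm, Subtype.ext ?_⟩
    rw [h, refl_opp_eq]
    simp [balancedCycle]
  · refine ⟨(i, 1), (j, 1), by simp [hij.ne], Subtype.ext ?_⟩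
    rw [h, refl_eq_of_fst_ne hij.ne]
    simp [pairedCycle]
  · refine ⟨(i, 1), (j, -1), by simp [hij.ne], Subtype.ext ?_⟩
    rw [h, refl_eq_of_fst_ne hij.ne]
    simp [pairedCycle]

theorem root_ne_zero {x y : SignedIdx n} (h : x ≠ y) : vec x - vec y ≠ 0 :=
  sub_ne_zero.2 (vec_injective.ne h)

/-- Both sides negate the root and fix its orthogonal complement. For `x = y` the root is zero and
both sides are the identity. -/
theorem rep_refl {x y : SignedIdx n} :
    rep (refl x y) = (ℝ ∙ (vec x - vec y))ᗮ.reflection := by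
  set a := vec x - vec y with ha
  have h1 : rep (refl x y) a = -a := by
    rw [ha, map_sub, rep_vec, rep_vec, refl_apply_left, refl_apply_right, neg_sub]
  have h2 : ∀ g, inner ℝ a g = 0 → rep (refl x y) g = g := by
    intro g hg
    rw [ha, inner_sub_left, inner_vec, inner_vec, sub_eq_zero] at hg
    rw [← mem_fixedSpace, mem_fixedSpace_rep]
    intro z
    rw [refl_apply]
    split_ifs with h1 h2 h3 h4
    · rw [h1, hg]
    · rw [h2, hg]
    · rw [h3, coord_opp, coord_opp, hg]
    · rw [h4, coord_opp, coord_opp, hg]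
    · rfl
  apply LinearIsometryEquiv.ext
  intro f
  obtain ⟨c, g, hg, rfl⟩ : ∃ (c : ℝ) (g : _), inner ℝ a g = 0 ∧ f = c • a + g := by
    by_cases h0 : a = 0
    · exact ⟨0, f, by simp [h0], by simp⟩
    · refine ⟨inner ℝ a f / inner ℝ a a, f - (inner ℝ a f / inner ℝ a a) • a, ?_, by simp⟩
      rw [inner_sub_right, inner_smul_right, div_mul_cancel₀, sub_self]
      exact inner_self_ne_zero.2 h0
  rw [map_add, map_add, map_smul, map_smul, h1, h2 g hg,
    Submodule.reflection_orthogonalComplement_singleton_eq_neg,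
    Submodule.reflection_mem_subspace_eq_self]
  exact Submodule.mem_orthogonal_singleton_iff_inner_right.2 hg

/-! ### The absolute length is the codimension of the fixed space -/

theorem codimFixed_rep_le_absLength (w : B n) :
    codimFixed (rep w) ≤ absLength (reflections n) w := by
  obtain ⟨l, hl, hlen, rfl⟩ := exists_list_absLength (exists_list_reflections n) w
  rw [← hlen]
  clear hlen
  induction l with
  | nil =>
    simp only [List.prod_nil, map_one, List.length_nil, Nat.le_zero]
    have h := finrank_fixedSpace_add (1 : EuclideanSpace ℝ (Fin n) ≃ₗᵢ[ℝ] _)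
    have h1 : fixedSpace (1 : EuclideanSpace ℝ (Fin n) ≃ₗᵢ[ℝ] _) = ⊤ :=
      eq_top_iff.2 fun x _ => rfl
    rw [h1, finrank_top] at h
    omega
  | cons t l ih =>
    rw [List.prod_cons, map_mul, List.length_cons, add_comm]
    refine (codimFixed_mul_le _ _).trans (add_le_add ?_ (ih fun s hs => hl s (by simp [hs])))
    obtain ⟨x, y, hxy, rfl⟩ := exists_refl_of_mem_reflections (hl t (by simp))
    rw [rep_refl, codimFixed_reflection (root_ne_zero hxy)]

theorem root_mem_orthogonal_fixedSpace {w : B n} {x y : SignedIdx n} :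
    vec x - vec y ∈ (fixedSpace (rep w))ᗮ ↔ ∀ f ∈ fixedSpace (rep w), coord x f = coord y f := by
  rw [Submodule.mem_orthogonal']
  simp only [inner_sub_left, inner_vec, sub_eq_zero]

/-- If `w` moves `x`, fixed vectors have equal coordinates at `x` and `w x`, so the root `vec x -
vec (w x)` is orthogonal to the fixed space and its reflection lowers the codimension by one.
Iterating writes `w` as a product of that many reflections. -/
theorem absLength_le_codimFixed_rep (w : B n) :
    absLength (reflections n) w ≤ codimFixed (rep w) := by
  induction hk : codimFixed (rep w) generalizing w with
  | zero =>
    have h : fixedSpace (rep w) = ⊤ := by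
      rw [← Submodule.orthogonal_eq_bot_iff]
      exact Submodule.finrank_eq_zero.1 hk
    have h1 : w = 1 := by
      apply ext_apply
      intro x
      exact vec_mem_fixedSpace_rep.1 (h ▸ Submodule.mem_top)
    rw [h1, absLength_one]
  | succ k ih =>
    obtain ⟨x, hx⟩ : ∃ x, w.1 x ≠ x := by
      by_contra! h
      have h1 : w = 1 := ext_apply h
      have h2 := codimFixed_rep_le_absLength w
      rw [h1, absLength_one, ← h1] at h2
      omega
    have h1 : codimFixed (rep (refl x (w.1 x) * w)) + 1 = codimFixed (rep w) := by
      rw [map_mul, rep_refl]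
      apply codimFixed_reflection_mul (root_ne_zero hx.symm)
      rw [root_mem_orthogonal_fixedSpace]
      intro f hf
      exact (mem_fixedSpace_rep.1 hf x).symm
    have h2 := ih (refl x (w.1 x) * w) (by omega)
    have h3 := absLength_mul_le (exists_list_reflections n) (refl x (w.1 x))
      (refl x (w.1 x) * w)
    rw [← mul_assoc, refl_mul_self, one_mul] at h3
    have h4 : absLength (reflections n) (refl x (w.1 x)) ≤ 1 :=
      Nat.sInf_le ⟨[refl x (w.1 x)], by simpa using refl_mem_reflections hx.symm, by simp⟩
    omega

/-- Carter's formula: the absolute length is the codimension of the fixed space. -/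
theorem absLength_eq_codimFixed (w : B n) :
    absLength (reflections n) w = codimFixed (rep w) :=
  le_antisymm (absLength_le_codimFixed_rep w) (codimFixed_rep_le_absLength w)

end Representation

/-! ### The absolute order in terms of fixed spaces -/

section Order

variable {n : ℕ}

theorem le_iff_absLength {u w : B n} : u ≤ w ↔
    absLength (reflections n) u + absLength (reflections n) (u⁻¹ * w) =
      absLength (reflections n) w := Iff.rfl

theorem le_iff_codimFixed {u w : B n} : u ≤ w ↔
    codimFixed (rep u) + codimFixed ((rep u)⁻¹ * rep w) = codimFixed (rep w) := by
  rw [le_iff_absLength, absLength_eq_codimFixed, absLength_eq_codimFixed, absLength_eq_codimFixed,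
    map_mul, map_inv]

theorem fixedSpace_le_of_le {u w : B n} (h : u ≤ w) :
    fixedSpace (rep w) ≤ fixedSpace (rep u) :=
  fixedSpace_le_of_codim (le_iff_codimFixed.1 h)

theorem le_of_fixedSpace_le {u v w : B n} (hu : u ≤ w) (hv : v ≤ w)
    (h : fixedSpace (rep v) ≤ fixedSpace (rep u)) : u ≤ v :=
  le_iff_codimFixed.2
    (codim_of_fixedSpace_le (le_iff_codimFixed.1 hu) (le_iff_codimFixed.1 hv) h)

theorem eq_of_fixedSpace_le {u w : B n} (hu : u ≤ w)
    (h : fixedSpace (rep u) ≤ fixedSpace (rep w)) : u = w :=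
  le_antisymm hu (le_of_fixedSpace_le le_rfl hu h)

theorem eq_of_le_of_absLength_le {u w : B n} (h : u ≤ w)
    (h' : absLength (reflections n) w ≤ absLength (reflections n) u) : u = w := by
  rw [le_iff_absLength] at h
  exact inv_mul_eq_one.1 (eq_one_of_absLength (exists_list_reflections n) (by omega))

theorem one_le_B (w : B n) : 1 ≤ w := by
  rw [le_iff_absLength, absLength_one, inv_one, one_mul, zero_add]

/-- Conjugation by `g` carries fixed vectors to fixed vectors, giving one inequality; conjugating
back gives the other. -/
theorem absLength_conj (g w : B n) :
    absLength (reflections n) (g * w * g⁻¹) = absLength (reflections n) w := by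
  have key : ∀ g w : B n, absLength (reflections n) (g * w * g⁻¹) ≤
      absLength (reflections n) w := by
    intro g w
    rw [absLength_eq_codimFixed, absLength_eq_codimFixed]
    have h1 := finrank_fixedSpace_add (rep w)
    have h2 := finrank_fixedSpace_add (rep (g * w * g⁻¹))
    have h3 : (fixedSpace (rep w)).map (rep g).toLinearEquiv.toLinearMap ≤
        fixedSpace (rep (g * w * g⁻¹)) := by
      rintro _ ⟨x, hx, rfl⟩
      rw [mem_fixedSpace, map_mul, map_mul]
      change rep g (rep w (rep g⁻¹ (rep g x))) = rep g x
      have h : rep g⁻¹ (rep g x) = x := by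
        change (rep g⁻¹ * rep g) x = x
        rw [← map_mul, inv_mul_cancel, map_one]
        rfl
      rw [h, mem_fixedSpace.1 hx]
    have h4 := Submodule.finrank_mono h3
    rw [LinearEquiv.finrank_map_eq] at h4
    omega
  refine le_antisymm (key g w) ?_
  have h := key g⁻¹ (g * w * g⁻¹)
  simpa [mul_assoc] using h

theorem mul_inv_le {u w : B n} (h : u ≤ w) : w * u⁻¹ ≤ w := by
  rw [le_iff_absLength] at h ⊢
  have h1 := absLength_conj u (u⁻¹ * w)
  rw [mul_inv_cancel_left] at h1
  rw [mul_inv_rev, inv_inv, inv_mul_cancel_right, h1]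
  omega

theorem inv_mul_le {u w : B n} (h : u ≤ w) : u⁻¹ * w ≤ w := by
  rw [le_iff_absLength] at h ⊢
  have h1 := absLength_conj w⁻¹ u
  rw [inv_inv] at h1
  rw [mul_inv_rev, inv_inv, h1]
  omega

/-- Translation by `z⁻¹` is an order embedding on the elements above `z`. -/
theorem inv_mul_le_inv_mul_iff {z x y : B n} (hx : z ≤ x) (hy : z ≤ y) :
    z⁻¹ * x ≤ z⁻¹ * y ↔ x ≤ y := by
  rw [le_iff_absLength] at hx hy
  have h : (z⁻¹ * x)⁻¹ * (z⁻¹ * y) = x⁻¹ * y := by simp [mul_assoc]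
  rw [le_iff_absLength, le_iff_absLength, h]
  omega

/-- If `s ≤ z⁻¹ w` and `z ≤ w`, then `z ≤ z s ≤ w`. -/
theorem le_mul_of_le_inv_mul {z w s : B n} (hz : z ≤ w) (hs : s ≤ z⁻¹ * w) :
    z ≤ z * s ∧ z * s ≤ w := by
  rw [le_iff_absLength] at hz hs
  have h1 := absLength_mul_le (exists_list_reflections n) z s
  have h2 := absLength_mul_le (exists_list_reflections n) (z * s) ((z * s)⁻¹ * w)
  have h3 : (z * s)⁻¹ * w = s⁻¹ * (z⁻¹ * w) := by simp [mul_assoc]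
  rw [mul_inv_cancel_left, h3] at h2
  rw [le_iff_absLength, le_iff_absLength, inv_mul_cancel_left, h3]
  omega

theorem absLength_refl {x y : SignedIdx n} (h : x ≠ y) :
    absLength (reflections n) (refl x y) = 1 := by
  rw [absLength_eq_codimFixed, rep_refl, codimFixed_reflection (root_ne_zero h)]

theorem mem_fixedSpace_refl {x y : SignedIdx n} {f : EuclideanSpace ℝ (Fin n)} :
    f ∈ fixedSpace (rep (refl x y)) ↔ coord x f = coord y f := by
  rw [rep_refl, fixedSpace_reflection, Submodule.mem_orthogonal_singleton_iff_inner_right,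
    inner_sub_left, inner_vec, inner_vec, sub_eq_zero]

/-- The condition says that the root is orthogonal to the fixed space of `w`, which is exactly when
the reflection lowers the length. -/
theorem refl_le_iff {x y : SignedIdx n} {w : B n} :
    refl x y ≤ w ↔ ∀ f ∈ fixedSpace (rep w), coord x f = coord y f := by
  by_cases hxy : x = y
  · subst hxy
    simp [refl_self, one_le_B]
  constructor
  · intro h f hf
    exact mem_fixedSpace_refl.1 (fixedSpace_le_of_le h hf)
  · intro h
    have h1 := codimFixed_reflection_mul (root_ne_zero hxy) (root_mem_orthogonal_fixedSpace.2 h)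
    rw [← rep_refl, ← map_mul, ← absLength_eq_codimFixed, ← absLength_eq_codimFixed] at h1
    rw [le_iff_absLength, absLength_refl hxy, refl_inv]
    omega

theorem exists_refl_of_absLength_eq_one {w : B n} (h : absLength (reflections n) w = 1) :
    ∃ x y, x ≠ y ∧ w = refl x y := by
  obtain ⟨l, hl, hlen, hp⟩ := exists_list_absLength (exists_list_reflections n) w
  rw [h, List.length_eq_one_iff] at hlen
  obtain ⟨t, rfl⟩ := hlen
  rw [List.prod_singleton] at hp
  subst hp
  exact exists_refl_of_mem_reflections (hl t (by simp))

theorem refl_apply_le (w : B n) (x : SignedIdx n) : refl x (w.1 x) ≤ w :=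
  refl_le_iff.2 fun _ hf => (mem_fixedSpace_rep.1 hf x).symm

theorem exists_refl_le {w : B n} (h : w ≠ 1) : ∃ x y, x ≠ y ∧ refl x y ≤ w := by
  obtain ⟨x, hx⟩ : ∃ x, w.1 x ≠ x := by
    by_contra! h'
    exact h (ext_apply h')
  exact ⟨x, w.1 x, hx.symm, refl_apply_le w x⟩

/-! ### Cycles and fixed vectors -/

theorem sameCycle_opp {w : B n} {x y : SignedIdx n} (h : w.1.SameCycle x y) :
    w.1.SameCycle (opp x) (opp y) := by
  obtain ⟨k, rfl⟩ := h.exists_nat_pow_eq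
  refine ⟨k, ?_⟩
  rw [zpow_natCast]
  exact apply_opp (w ^ k) x

theorem coord_eq_of_sameCycle {w : B n} {x y : SignedIdx n} (h : w.1.SameCycle x y)
    {f : EuclideanSpace ℝ (Fin n)} (hf : f ∈ fixedSpace (rep w)) : coord x f = coord y f := by
  obtain ⟨k, rfl⟩ := h.exists_nat_pow_eq
  induction k with
  | zero => rfl
  | succ k ih =>
    rw [ih ⟨k, by simp⟩, pow_succ', Equiv.Perm.mul_apply, mem_fixedSpace_rep.1 hf]

theorem coord_eq_zero_of_sameCycle_opp {w : B n} {x : SignedIdx n} (h : w.1.SameCycle x (opp x))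
    {f : EuclideanSpace ℝ (Fin n)} (hf : f ∈ fixedSpace (rep w)) : coord x f = 0 := by
  have h1 := coord_eq_of_sameCycle h hf
  rw [coord_opp] at h1
  linarith

open Classical in
/-- The signed indicator vector of a paired cycle. -/
theorem exists_mem_fixedSpace_of_not_sameCycle {w : B n} {x : SignedIdx n}
    (h : ¬ w.1.SameCycle x (opp x)) : ∃ f ∈ fixedSpace (rep w), coord x f = 1 ∧
      ∀ y, ¬ w.1.SameCycle x y → coord y f ≠ 1 := by
  -- The indicator of the cycle of `x` minus that of the opposite cycle; these are disjoint because
  -- the cycle is not balanced.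
  set φ : SignedIdx n → ℝ := fun y =>
    (if w.1.SameCycle x y then 1 else 0) - (if w.1.SameCycle x (opp y) then 1 else 0) with hφ
  set f : EuclideanSpace ℝ (Fin n) := WithLp.toLp 2 fun i => φ (i, 1) with hf
  have hc : ∀ y, coord y f = φ y := by
    rintro ⟨i, e⟩
    rcases Int.units_eq_one_or e with rfl | rfl
    · rw [coord_one]
    · have h1 : ((i, -1) : SignedIdx n) = opp (i, 1) := rfl
      rw [h1, coord_opp, coord_one]
      simp [hf, hφ, opp_opp]
  refine ⟨f, mem_fixedSpace_rep.2 fun y => ?_, ?_, fun y hy => ?_⟩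
  · rw [hc, hc, hφ]
    simp only [← apply_opp, Equiv.Perm.sameCycle_apply_right]
  · simp [hc, hφ, h, Equiv.Perm.SameCycle.refl]
  · rw [hc, hφ]
    simp only [hy, if_false]
    split_ifs <;> norm_num

/-- Fixed vectors are constant along cycles and vanish on balanced ones; in all other cases a signed
indicator vector separates `x` from `y`. This makes the order relation a question about orbits,
hence computable. -/
theorem refl_le_iff_sameCycle {w : B n} {x y : SignedIdx n} :
    refl x y ≤ w ↔ w.1.SameCycle x y ∨ (w.1.SameCycle x (opp x) ∧ w.1.SameCycle y (opp y)) := by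
  rw [refl_le_iff]
  constructor
  · intro h
    by_contra! h'
    obtain ⟨h1, h2⟩ := h'
    by_cases h3 : w.1.SameCycle x (opp x)
    · obtain ⟨f, hf, hf1, -⟩ := exists_mem_fixedSpace_of_not_sameCycle (h2 h3)
      rw [← h f hf, coord_eq_zero_of_sameCycle_opp h3 hf] at hf1
      exact zero_ne_one hf1
    · obtain ⟨f, hf, hf1, hf2⟩ := exists_mem_fixedSpace_of_not_sameCycle h3
      exact hf2 y h1 (by rw [← h f hf, hf1])
  · rintro (h | ⟨h1, h2⟩) f hf
    · exact coord_eq_of_sameCycle h hf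
    · rw [coord_eq_zero_of_sameCycle_opp h1 hf, coord_eq_zero_of_sameCycle_opp h2 hf]

theorem sameCycle_opp_iff {w : B n} {x : SignedIdx n} :
    w.1.SameCycle x (opp x) ↔ ∀ f ∈ fixedSpace (rep w), coord x f = 0 := by
  constructor
  · intro h f hf
    exact coord_eq_zero_of_sameCycle_opp h hf
  · intro h
    by_contra h'
    obtain ⟨f, hf, hf1, -⟩ := exists_mem_fixedSpace_of_not_sameCycle h'
    rw [h f hf] at hf1
    exact zero_ne_one hf1

/-! ### Restriction to a set of coordinates -/

theorem sameCycle_of_forall_apply {u w : Equiv.Perm (SignedIdx n)}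
    (h : ∀ v, w.SameCycle v (u v)) {x y : SignedIdx n} (hxy : u.SameCycle x y) :
    w.SameCycle x y := by
  obtain ⟨k, rfl⟩ := hxy.exists_nat_pow_eq
  clear hxy
  induction k with
  | zero => exact Equiv.Perm.SameCycle.refl _ _
  | succ k ih =>
    rw [pow_succ', Equiv.Perm.mul_apply]
    exact ih.trans (h _)

/-- Left multiplication by `refl z (w z)` erases `z` and `opp z` from the cycles of `w`: away from
them nothing changes, and predecessors skip over them. This and the next lemma are the two cases. -/
theorem remove_apply_of_fst_ne {w : B n} {z v : SignedIdx n} (hv : v.1 ≠ z.1)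
    (hwv : (w.1 v).1 ≠ z.1) : (refl z (w.1 z) * w).1 v = w.1 v := by
  rw [mul_apply, refl_apply, if_neg, if_neg, if_neg, if_neg]
  · rw [← apply_opp, w.1.injective.eq_iff]
    rintro rfl
    exact hv rfl
  · rintro h
    exact hwv (by rw [h, fst_opp])
  · rw [w.1.injective.eq_iff]
    rintro rfl
    exact hv rfl
  · rintro h
    exact hwv (by rw [h])

theorem remove_apply_of_fst_eq {w : B n} {z v : SignedIdx n} (hv : v.1 ≠ z.1)
    (hwv : (w.1 v).1 = z.1) : (refl z (w.1 z) * w).1 v = w.1 (w.1 v) := by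
  rw [mul_apply]
  rcases fst_eq_iff.1 hwv with h | h
  · rw [h, refl_apply_left]
  · rw [refl_apply, h, if_neg (opp_ne z), if_neg, if_pos rfl, apply_opp]
    rw [← h, w.1.injective.eq_iff]
    rintro rfl
    exact hv rfl

theorem sameCycle_remove_apply (w : B n) (z v : SignedIdx n) :
    w.1.SameCycle v ((refl z (w.1 z) * w).1 v) := by
  by_cases hv : v.1 = z.1
  · have h : (refl z (w.1 z) * w).1 z = z := by rw [mul_apply, refl_apply_right]
    rcases fst_eq_iff.1 hv with rfl | rfl
    · rw [h]
    · rw [apply_opp, h]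
  · by_cases hwv : (w.1 v).1 = z.1
    · rw [remove_apply_of_fst_eq hv hwv]
      simp [Equiv.Perm.SameCycle.refl]
    · rw [remove_apply_of_fst_ne hv hwv]
      simp [Equiv.Perm.SameCycle.refl]

theorem sameCycle_remove {w : B n} {z : SignedIdx n} {x y : SignedIdx n} (hx : x.1 ≠ z.1)
    (hy : y.1 ≠ z.1) (h : w.1.SameCycle x y) : (refl z (w.1 z) * w).1.SameCycle x y := by
  obtain ⟨k, hk⟩ := h.exists_nat_pow_eq
  clear h
  induction k using Nat.strong_induction_on generalizing x with
  | _ k ih =>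
    match k, hk with
    | 0, hk =>
      rw [← hk]
      exact Equiv.Perm.SameCycle.refl _ _
    | 1, hk =>
      rw [pow_one] at hk
      subst hk
      rw [← remove_apply_of_fst_ne hx hy]
      exact Equiv.Perm.sameCycle_apply_right.2 (Equiv.Perm.SameCycle.refl _ _)
    | k + 2, hk =>
      by_cases h1 : (w.1 x).1 = z.1
      · have h2 : (w.1 (w.1 x)).1 ≠ z.1 := by
          intro h2
          apply hx
          rw [← h1] at h2 ⊢
          rcases fst_eq_iff.1 h2 with h3 | h3
          · exact congrArg Prod.fst (w.1.injective h3).symm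
          · rw [← apply_opp] at h3
            rw [w.1.injective h3, fst_opp]
        have h3 := ih k (by omega) h2 (by
          rw [pow_add, Equiv.Perm.mul_apply] at hk
          exact hk)
        rw [← remove_apply_of_fst_eq hx h1] at h3
        exact Equiv.Perm.sameCycle_apply_left.1 h3
      · have h3 := ih (k + 1) (by omega) h1 (by
          rw [pow_succ, Equiv.Perm.mul_apply] at hk
          exact hk)
        rw [← remove_apply_of_fst_ne hx h1] at h3
        exact Equiv.Perm.sameCycle_apply_left.1 h3

theorem remove_le (w : B n) (z : SignedIdx n) : refl z (w.1 z) * w ≤ w := by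
  simpa [refl_inv] using inv_mul_le (refl_apply_le w z)

/-- The new element fixes `vec z` and all that `w` fixes; if `w` moves `z`, its length is smaller by
exactly one, so there is no room for more. -/
theorem fixedSpace_remove (w : B n) (z : SignedIdx n) :
    fixedSpace (rep (refl z (w.1 z) * w)) = fixedSpace (rep w) ⊔ (ℝ ∙ vec z) := by
  have hle : fixedSpace (rep w) ⊔ (ℝ ∙ vec z) ≤ fixedSpace (rep (refl z (w.1 z) * w)) := by
    apply sup_le (fixedSpace_le_of_le (remove_le w z))
    rw [Submodule.span_singleton_le_iff_mem, vec_mem_fixedSpace_rep, mul_apply, refl_apply_right]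
  by_cases hz : w.1 z = z
  · refine le_antisymm ?_ hle
    rw [hz, refl_self, one_mul]
    exact le_sup_left
  · refine (Submodule.eq_of_le_of_finrank_le hle ?_).symm
    have h1 : fixedSpace (rep w) < fixedSpace (rep w) ⊔ (ℝ ∙ vec z) := by
      rw [left_lt_sup, Submodule.span_singleton_le_iff_mem, vec_mem_fixedSpace_rep]
      exact hz
    have h2 := Submodule.finrank_lt_finrank_of_lt h1
    have h3 := refl_apply_le w z
    rw [le_iff_absLength, absLength_refl (Ne.symm hz), refl_inv, absLength_eq_codimFixed,
      absLength_eq_codimFixed] at h3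
    have h4 := finrank_fixedSpace_add (rep w)
    have h5 := finrank_fixedSpace_add (rep (refl z (w.1 z) * w))
    omega

/-- The largest element below `w` fixing the coordinates in `D`, obtained by erasing these
coordinates from the cycles of `w`. -/
theorem exists_restrict (w : B n) (D : Finset (Fin n)) : ∃ u ≤ w,
    fixedSpace (rep u) = fixedSpace (rep w) ⊔
      Submodule.span ℝ ((fun i => vec (i, 1)) '' (D : Set (Fin n))) ∧
    (∀ v, w.1.SameCycle v (u.1 v)) ∧
    (∀ v, v.1 ∉ D → (w.1 v).1 ∉ D → u.1 v = w.1 v) ∧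
    (∀ v v', v.1 ∉ D → v'.1 ∉ D → w.1.SameCycle v v' → u.1.SameCycle v v') := by
  induction D using Finset.induction_on with
  | empty =>
    refine ⟨w, le_rfl, by simp, fun v => ?_, by simp, by simp⟩
    simp [Equiv.Perm.SameCycle.refl]
  | insert i D hi ih =>
    obtain ⟨u, h1, h2, h3, h4, h5⟩ := ih
    refine ⟨refl (i, 1) (u.1 (i, 1)) * u, (remove_le u _).trans h1, ?_, fun v => ?_,
      fun v hv hwv => ?_, fun v v' hv hv' h => ?_⟩
    · rw [fixedSpace_remove, h2, Finset.coe_insert, Set.image_insert_eq, Submodule.span_insert,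
        sup_assoc, sup_comm (ℝ ∙ vec (i, 1))]
    · exact sameCycle_of_forall_apply h3 (sameCycle_remove_apply u (i, 1) v)
    · rw [Finset.mem_insert, not_or] at hv hwv
      have h := h4 v hv.2 hwv.2
      rw [← h] at hwv ⊢
      exact remove_apply_of_fst_ne hv.1 hwv.1
    · rw [Finset.mem_insert, not_or] at hv hv'
      exact sameCycle_remove hv.1 hv'.1 (h5 v v' hv.2 hv'.2 h)

end Order

/-! ### A local criterion for being a lattice -/

section Lattice

variable {P : Type*} [PartialOrder P]

/-- Induction on `z` from the top: choose `C`-steps `x' ≤ x` and `y' ≤ y` with join `j`, then form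
`p = x ∨ j` above `x'`, `q = y ∨ j` above `y'`, and finally `p ∨ q` above `j`. -/
theorem exists_isLUB_of_local [Finite P] (C : P → P → Prop)
    (hC : ∀ z x, z < x → ∃ y, C z y ∧ z < y ∧ y ≤ x)
    (hj : ∀ z x y, C z x → C z y → ∃ j, IsLUB {x, y} j) (z : P) :
    ∀ x y, z ≤ x → z ≤ y → ∃ j, IsLUB {x, y} j := by
  induction z using WellFoundedGT.induction with
  | _ z ih =>
    intro x y hx hy
    rcases hx.eq_or_lt with rfl | hx
    · exact ⟨y, by simpa [IsLUB, IsLeast, upperBounds, lowerBounds] using hy⟩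
    rcases hy.eq_or_lt with rfl | hy
    · exact ⟨x, by simpa [Set.pair_comm x, IsLUB, IsLeast, upperBounds, lowerBounds] using hx.le⟩
    obtain ⟨x', hx1, hx2, hx3⟩ := hC z x hx
    obtain ⟨y', hy1, hy2, hy3⟩ := hC z y hy
    obtain ⟨j, hj1⟩ := hj z x' y' hx1 hy1
    have hjx : x' ≤ j := hj1.1 (by simp)
    have hjy : y' ≤ j := hj1.1 (by simp)
    obtain ⟨p, hp⟩ := ih x' hx2 x j hx3 hjx
    obtain ⟨q, hq⟩ := ih y' hy2 y j hy3 hjy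
    obtain ⟨r, hr⟩ := ih j (hx2.trans_le hjx) p q (hp.1 (by simp)) (hq.1 (by simp))
    refine ⟨r, ?_, fun m hm => hr.2 ?_⟩
    · rintro _ (rfl | rfl)
      · exact (hp.1 (by simp)).trans (hr.1 (by simp))
      · exact (hq.1 (by simp)).trans (hr.1 (by simp))
    · have hmx : x ≤ m := hm (by simp)
      have hmy : y ≤ m := hm (by simp)
      have hmj : j ≤ m := hj1.2 (by
        rintro _ (rfl | rfl)
        exacts [hx3.trans hmx, hy3.trans hmy])
      rintro _ (rfl | rfl)
      · apply hp.2
        rintro _ (rfl | rfl)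
        exacts [hmx, hmj]
      · apply hq.2
        rintro _ (rfl | rfl)
        exacts [hmy, hmj]

/-- A maximal common lower bound is the greatest one, because its join with any other common lower
bound is again a common lower bound. -/
theorem isLatticePoset_of_exists_isLUB [Finite P] [OrderBot P]
    (h : ∀ x y : P, ∃ j, IsLUB {x, y} j) : IsLatticePoset P := by
  refine fun a b => ⟨h a b, ?_⟩
  obtain ⟨m, hm⟩ := (Set.toFinite {x | x ≤ a ∧ x ≤ b}).exists_maximal ⟨⊥, bot_le, bot_le⟩
  refine ⟨m, ?_, fun x hx => ?_⟩
  · rintro _ (rfl | rfl)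
    exacts [hm.prop.1, hm.prop.2]
  · obtain ⟨j, hj⟩ := h m x
    have h1 : m ≤ j := hj.1 (by simp)
    have h2 : x ≤ j := hj.1 (by simp)
    refine h2.trans (hm.le_of_ge ⟨hj.2 ?_, hj.2 ?_⟩ h1)
    · rintro _ (rfl | rfl)
      exacts [hm.prop.1, hx (by simp)]
    · rintro _ (rfl | rfl)
      exacts [hm.prop.2, hx (by simp)]

end Lattice

/-! ### A computation in the hyperoctahedral group of rank four -/

section RankFour

/-- Whether `y` is reached from `x` by at most `k` applications of `g`. -/
def reach {α : Type*} [DecidableEq α] (g : α → α) : ℕ → α → α → Bool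
  | 0, x, y => decide (x = y)
  | k + 1, x, y => decide (x = y) || reach g k (g x) y

theorem reach_iff {α : Type*} [DecidableEq α] (g : α → α) (k : ℕ) (x y : α) :
    reach g k x y = true ↔ ∃ i ≤ k, g^[i] x = y := by
  induction k generalizing x with
  | zero => simp [reach]
  | succ k ih =>
    rw [reach, Bool.or_eq_true, ih, decide_eq_true_iff]
    constructor
    · rintro (rfl | ⟨i, hi, rfl⟩)
      · exact ⟨0, by omega, rfl⟩
      · exact ⟨i + 1, by omega, rfl⟩
    · rintro ⟨_ | i, hi, rfl⟩
      · exact Or.inl rfl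
      · exact Or.inr ⟨i, by omega, rfl⟩

/-- The odd function on `{±1, ±2, ±3, ±4}` with the given values at `1, 2, 3, 4`. -/
def oddFun (a b c d x : SignedIdx 4) : SignedIdx 4 :=
  let y := match x.1 with
    | 0 => a
    | 1 => b
    | 2 => c
    | 3 => d
  if x.2 = 1 then y else opp y

/-- Whether `x` and `y` are on the same cycle of `g`, or both on balanced cycles. -/
def related (g : SignedIdx 4 → SignedIdx 4) (x y : SignedIdx 4) : Bool :=
  reach g 7 x y || (reach g 7 x (opp x) && reach g 7 y (opp y))

/-- The list of all elements of `{±1, ±2, ±3, ±4}`. -/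
def allIdx : List (SignedIdx 4) :=
  [(0, 1), (1, 1), (2, 1), (3, 1), (0, -1), (1, -1), (2, -1), (3, -1)]

/-- The roots up to sign, as differences of two signed basis vectors. -/
def rootPairs : List (SignedIdx 4 × SignedIdx 4) :=
  [((0, 1), (0, -1)), ((1, 1), (1, -1)), ((2, 1), (2, -1)), ((3, 1), (3, -1)),
   ((0, 1), (1, 1)), ((0, 1), (1, -1)), ((0, 1), (2, 1)), ((0, 1), (2, -1)),
   ((0, 1), (3, 1)), ((0, 1), (3, -1)), ((1, 1), (2, 1)), ((1, 1), (2, -1)),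
   ((1, 1), (3, 1)), ((1, 1), (3, -1)), ((2, 1), (3, 1)), ((2, 1), (3, -1))]

/-- The coatoms `g t` that are above both `((1, 2))` and `((3, 4))`, listed by the root of `t`. -/
def coatomsAbove (g : SignedIdx 4 → SignedIdx 4) : List (SignedIdx 4 × SignedIdx 4) :=
  rootPairs.filter fun p =>
    related (fun z => g (reflFun p.1 p.2 z)) (0, 1) (1, 1) &&
      related (fun z => g (reflFun p.1 p.2 z)) (2, 1) (3, 1)

/-- If all cycles of `g` are balanced, then `g² = -1`, or `((1, 2)) ((3, 4))` is below `g`, or at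
most one coatom is above both factors. -/
def coatomTest (g : SignedIdx 4 → SignedIdx 4) : Bool :=
  !(allIdx.all fun x => reach g 7 x (opp x)) || (allIdx.all fun x => decide (g (g x) = opp x)) ||
  related (fun z => reflFun (0, 1) (1, 1) (g z)) (2, 1) (3, 1) ||
  decide ((coatomsAbove g).length ≤ 1)

-- The check covers all odd functions, bijective or not. If every `x` reaches its opposite, the
-- function is surjective, so only permutations survive the first alternative.
set_option maxRecDepth 100000 in
theorem coatomTest_oddFun : (allIdx.all fun a => allIdx.all fun b => allIdx.all fun c =>
    allIdx.all fun d => coatomTest (oddFun a b c d)) = true := by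
  decide +kernel

theorem mem_allIdx : ∀ x : SignedIdx 4, x ∈ allIdx := by
  decide +kernel

theorem exists_rootPair : ∀ x y : SignedIdx 4, x ≠ y →
    ∃ p ∈ rootPairs, ∀ z, reflFun x y z = reflFun p.1 p.2 z := by
  decide +kernel

/-- Seven steps suffice, since a cycle has at most eight elements. -/
theorem reach_of_sameCycle {g : B 4} {x y : SignedIdx 4} (h : g.1.SameCycle x y) :
    reach g.1 7 x y = true := by
  rw [reach_iff]
  by_cases hx : x ∈ g.1.support
  · obtain ⟨i, hi, rfl⟩ := h.exists_pow_eq_of_mem_support hx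
    have h1 : (g.1.cycleOf x).support.card ≤ 8 := by
      refine (Finset.card_le_univ _).trans ?_
      simp
    exact ⟨i, by omega, by rw [Equiv.Perm.coe_pow]⟩
  · rw [Equiv.Perm.mem_support, not_not] at hx
    exact ⟨0, by omega, h.eq_of_left hx⟩

theorem related_iff {g : B 4} {x y : SignedIdx 4} :
    related g.1 x y = true ↔ refl x y ≤ g := by
  have key : ∀ x y, reach g.1 7 x y = true ↔ g.1.SameCycle x y := by
    intro x y
    refine ⟨fun h => ?_, reach_of_sameCycle⟩
    obtain ⟨i, -, rfl⟩ := (reach_iff _ _ _ _).1 h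
    refine ⟨i, ?_⟩
    rw [zpow_natCast, Equiv.Perm.coe_pow]
  rw [refl_le_iff_sameCycle, related, Bool.or_eq_true, Bool.and_eq_true, key, key, key]

theorem eq_oddFun (g : B 4) :
    oddFun (g.1 (0, 1)) (g.1 (1, 1)) (g.1 (2, 1)) (g.1 (3, 1)) = g.1 := by
  funext ⟨i, e⟩
  rcases Int.units_eq_one_or e with rfl | rfl
  · fin_cases i <;> rfl
  · have h : ((i, -1) : SignedIdx 4) = opp (i, 1) := rfl
    rw [h, apply_opp]
    fin_cases i <;> rfl

/-- Of the four alternatives in `coatomTest`, `hbal` excludes the first, `hsq` the second, and the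
two distinct coatoms the last. -/
theorem refl_le_refl_mul_of_coatoms {g : B 4} (hbal : ∀ x, g.1.SameCycle x (opp x))
    (hsq : ∃ x, g.1 (g.1 x) ≠ opp x) {x y x' y' : SignedIdx 4} (hxy : x ≠ y) (hxy' : x' ≠ y')
    (hne : refl x y ≠ refl x' y')
    (h1 : refl (0, 1) (1, 1) ≤ g * refl x y) (h2 : refl (2, 1) (3, 1) ≤ g * refl x y)
    (h1' : refl (0, 1) (1, 1) ≤ g * refl x' y') (h2' : refl (2, 1) (3, 1) ≤ g * refl x' y') :
    refl (2, 1) (3, 1) ≤ refl (0, 1) (1, 1) * g := by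
  have htest : coatomTest g.1 = true := by
    have h := coatomTest_oddFun
    simp only [List.all_eq_true] at h
    have h' := h (g.1 (0, 1)) (mem_allIdx _) (g.1 (1, 1)) (mem_allIdx _) (g.1 (2, 1))
      (mem_allIdx _) (g.1 (3, 1)) (mem_allIdx _)
    rwa [eq_oddFun] at h'
  rw [coatomTest, Bool.or_eq_true, Bool.or_eq_true, Bool.or_eq_true] at htest
  rcases htest with ((h | h) | h) | h
  · have h3 : (allIdx.all fun x => reach g.1 7 x (opp x)) = true :=
      List.all_eq_true.2 fun z _ => reach_of_sameCycle (hbal z)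
    rw [h3] at h
    exact absurd h (by decide)
  · obtain ⟨z, hz⟩ := hsq
    rw [List.all_eq_true] at h
    exact absurd (of_decide_eq_true (h z (mem_allIdx z))) hz
  · rw [← related_iff]
    exact h
  · have hmem : ∀ {x y : SignedIdx 4}, x ≠ y → refl (0, 1) (1, 1) ≤ g * refl x y →
        refl (2, 1) (3, 1) ≤ g * refl x y →
        ∃ p ∈ coatomsAbove g.1, refl x y = refl p.1 p.2 := by
      intro x y hxy h1 h2
      obtain ⟨p, hp, hpz⟩ := exists_rootPair x y hxy
      have heq : refl x y = refl p.1 p.2 := ext_apply hpz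
      rw [heq, ← related_iff] at h1 h2
      refine ⟨p, List.mem_filter.2 ⟨hp, ?_⟩, heq⟩
      rw [Bool.and_eq_true]
      exact ⟨h1, h2⟩
    obtain ⟨p, hp, hpe⟩ := hmem hxy h1 h2
    obtain ⟨p', hp', hpe'⟩ := hmem hxy' h1' h2'
    have hlen := of_decide_eq_true h
    rw [hpe, hpe'] at hne
    match hl : coatomsAbove g.1, hlen with
    | [], _ => simp [hl] at hp
    | [c], _ =>
      rw [hl, List.mem_singleton] at hp hp'
      exact absurd (by rw [hp, hp']) hne
    | _ :: _ :: _, hlen => simp at hlen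

end RankFour

/-! ### Elements above a product of two balanced two-cycles -/

section DoubleTwoCycle

variable {n m : ℕ}

/-- `u` is the product of the disjoint balanced cycles `[a, u a]` and `[c, u c]`. -/
def IsDoubleTwoCycle (u : B n) (a c : SignedIdx n) : Prop :=
  u.1 (u.1 a) = opp a ∧ u.1 (u.1 c) = opp c ∧ c.1 ≠ a.1 ∧ c.1 ≠ (u.1 a).1 ∧
    ∀ z, z.1 ≠ a.1 → z.1 ≠ (u.1 a).1 → z.1 ≠ c.1 → z.1 ≠ (u.1 c).1 → u.1 z = z

/-- `w` lies above a product of two disjoint balanced two-cycles. -/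
def AboveDoubleTwoCycle (w : B n) : Prop := ∃ u ≤ w, ∃ a c, IsDoubleTwoCycle u a c

theorem AboveDoubleTwoCycle.mono {v w : B n} (h : AboveDoubleTwoCycle v) (hvw : v ≤ w) :
    AboveDoubleTwoCycle w := by
  obtain ⟨u, hu, h⟩ := h
  exact ⟨u, hu.trans hvw, h⟩

theorem fst_apply_eq_iff {u : B n} {x y : SignedIdx n} : (u.1 x).1 = (u.1 y).1 ↔ x.1 = y.1 := by
  rw [fst_eq_iff, fst_eq_iff, ← apply_opp, u.1.injective.eq_iff, u.1.injective.eq_iff]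

theorem fst_apply_ne {u : B n} {a : SignedIdx n} (h : u.1 (u.1 a) = opp a) :
    (u.1 a).1 ≠ a.1 := by
  intro h'
  rcases fst_eq_iff.1 h' with h1 | h1
  · rw [h1, h1] at h
    exact opp_ne a h.symm
  · rw [h1, apply_opp, h1, opp_opp] at h
    exact opp_ne a h.symm

/-! ### Embeddings of smaller hyperoctahedral groups -/

/-- The odd map `{±1, …, ±m} → {±1, …, ±n}` with prescribed values on positive elements. -/
def emb (v : Fin m → SignedIdx n) (x : SignedIdx m) : SignedIdx n :=
  ((v x.1).1, x.2 * (v x.1).2)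

theorem emb_opp (v : Fin m → SignedIdx n) (x : SignedIdx m) : emb v (opp x) = opp (emb v x) := by
  simp [emb, opp]

theorem emb_one (v : Fin m → SignedIdx n) (i : Fin m) : emb v (i, 1) = v i := by
  simp [emb]

theorem emb_injective {v : Fin m → SignedIdx n} (hv : Function.Injective fun i => (v i).1) :
    Function.Injective (emb v) := by
  rintro ⟨i, e⟩ ⟨j, f⟩ h
  have h0 := congrArg Prod.fst h
  have h1 : i = j := hv h0
  subst h1
  have h2 := congrArg Prod.snd h
  simp only [emb, mul_left_inj] at h2
  rw [h2]

theorem exists_emb_eq {v : Fin m → SignedIdx n} {z : SignedIdx n} (hz : ∃ i, z.1 = (v i).1) :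
    ∃ x, emb v x = z := by
  obtain ⟨i, hi⟩ := hz
  rcases fst_eq_iff.1 hi with h | h
  · exact ⟨(i, 1), by rw [emb_one, h]⟩
  · exact ⟨opp (i, 1), by rw [emb_opp, emb_one, h]⟩

/-- `u` acts on the image of `emb v` as `g`. -/
def ActsAs (v : Fin m → SignedIdx n) (u : B n) (g : B m) : Prop :=
  ∀ x, u.1 (emb v x) = emb v (g.1 x)

theorem ActsAs.mul {v : Fin m → SignedIdx n} {u u' : B n} {g g' : B m} (h : ActsAs v u g)
    (h' : ActsAs v u' g') : ActsAs v (u * u') (g * g') := by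
  intro x
  rw [mul_apply, mul_apply, h', h]

theorem actsAs_refl {v : Fin m → SignedIdx n} (hv : Function.Injective fun i => (v i).1)
    (x y : SignedIdx m) : ActsAs v (refl (emb v x) (emb v y)) (refl x y) := by
  intro z
  simp only [refl_apply, ← emb_opp, (emb_injective hv).eq_iff]
  split_ifs <;> rfl

theorem ActsAs.sameCycle_iff {v : Fin m → SignedIdx n} (hv : Function.Injective fun i => (v i).1)
    {u : B n} {g : B m} (h : ActsAs v u g) {x y : SignedIdx m} :
    u.1.SameCycle (emb v x) (emb v y) ↔ g.1.SameCycle x y := by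
  have key : ∀ k : ℕ, (u.1 ^ k) (emb v x) = emb v ((g.1 ^ k) x) := by
    intro k
    induction k with
    | zero => rfl
    | succ k ih => rw [pow_succ', Equiv.Perm.mul_apply, ih, h, pow_succ', Equiv.Perm.mul_apply]
  constructor
  · intro h'
    obtain ⟨k, hk⟩ := h'.exists_nat_pow_eq
    rw [key, (emb_injective hv).eq_iff] at hk
    exact ⟨k, by rw [zpow_natCast, hk]⟩
  · intro h'
    obtain ⟨k, hk⟩ := h'.exists_nat_pow_eq
    refine ⟨k, ?_⟩
    rw [zpow_natCast, key, hk]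

theorem ActsAs.refl_le_iff {v : Fin m → SignedIdx n} (hv : Function.Injective fun i => (v i).1)
    {u : B n} {g : B m} (h : ActsAs v u g) {x y : SignedIdx m} :
    refl (emb v x) (emb v y) ≤ u ↔ refl x y ≤ g := by
  rw [refl_le_iff_sameCycle, refl_le_iff_sameCycle, ← emb_opp, ← emb_opp, h.sameCycle_iff hv,
    h.sameCycle_iff hv, h.sameCycle_iff hv]

theorem exists_actsAs {v : Fin m → SignedIdx n} (hv : Function.Injective fun i => (v i).1)
    {w : B n} (hw : ∀ z, (∀ i, z.1 ≠ (v i).1) → w.1 z = z) : ∃ g, ActsAs v w g := by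
  have h : ∀ x, ∃ y, emb v y = w.1 (emb v x) := by
    intro x
    apply exists_emb_eq
    by_contra! h
    have h1 := w.1.injective (hw _ h)
    rw [h1] at h
    exact h x.1 rfl
  choose g hg using h
  have hinj : Function.Injective g := by
    intro x y hxy
    have h1 := congrArg (emb v) hxy
    rw [hg, hg, w.1.injective.eq_iff] at h1
    exact emb_injective hv h1
  refine ⟨⟨Equiv.ofBijective g (Finite.injective_iff_bijective.1 hinj), fun x => ?_⟩,
    fun x => (hg x).symm⟩
  apply emb_injective hv
  change emb v (g (opp x)) = emb v (opp (g x))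
  rw [hg, emb_opp, emb_opp, hg, apply_opp]

/-- If `g² = -1`, then `g` is a product of two balanced two-cycles, one through `a` and one through
any index outside `±a` and `±g a`; hence `w` itself is the required element. -/
theorem aboveDoubleTwoCycle_of_actsAs {v : Fin 4 → SignedIdx n}
    (hv : Function.Injective fun i => (v i).1) {w : B n}
    (hw : ∀ z, (∀ i, z.1 ≠ (v i).1) → w.1 z = z) {g : B 4} (hg : ActsAs v w g)
    (hsq : ∀ x, g.1 (g.1 x) = opp x) : AboveDoubleTwoCycle w := by
  set a : SignedIdx 4 := (0, 1) with ha
  obtain ⟨i, hi1, hi2⟩ : ∃ i : Fin 4, i ≠ a.1 ∧ i ≠ (g.1 a).1 := by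
    generalize a.1 = j
    generalize (g.1 a).1 = k
    revert j k
    decide
  set c : SignedIdx 4 := (i, 1) with hc
  have cover : ∀ a b c d : Fin 4, b ≠ a → c ≠ a → c ≠ b → d ≠ c → d ≠ b → d ≠ a →
      ∀ j, j ≠ a → j ≠ b → j ≠ c → j = d := by
    omega
  have h1 := fst_apply_ne (hsq a)
  have h2 := fst_apply_ne (hsq c)
  have h3 : (g.1 c).1 ≠ (g.1 a).1 := by
    rw [Ne, fst_apply_eq_iff]
    exact hi1
  have h4 : (g.1 c).1 ≠ a.1 := by
    rw [Ne, ← fst_apply_eq_iff (u := g), hsq]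
    exact hi2
  have hsqw : ∀ x, w.1 (w.1 (emb v x)) = opp (emb v x) := by
    intro x
    rw [hg, hg, hsq, emb_opp]
  have hv' : ∀ x y : SignedIdx 4, (emb v x).1 ≠ (emb v y).1 ↔ x.1 ≠ y.1 :=
    fun x y => not_congr (hv.eq_iff (a := x.1) (b := y.1))
  refine ⟨w, le_rfl, emb v a, emb v c, hsqw a, hsqw c, (hv' _ _).2 hi1, ?_, ?_⟩
  · rw [hg]
    exact (hv' _ _).2 hi2
  · rw [hg, hg]
    intro z z1 z2 z3 z4
    apply hw
    intro j hj
    rw [hj] at z1 z2 z3 z4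
    have z1 := (hv' (j, 1) a).1 z1
    have z2 := (hv' (j, 1) (g.1 a)).1 z2
    have z3 := (hv' (j, 1) c).1 z3
    have z4 := (hv' (j, 1) (g.1 c)).1 z4
    exact z4 (cover _ _ _ _ h1 hi1 hi2 h2 h3 h4 _ z1 z2 z3)

theorem refl_comm (x y : SignedIdx n) : refl x y = refl y x := by
  apply ext_apply
  intro z
  rw [refl_apply, refl_apply]
  have h := @opp_injective n
  split_ifs <;> simp_all [h.eq_iff]

theorem eq_mul_refl_of_coatom {u w : B n} (hu : u ≤ w)
    (hlen : absLength (reflections n) u + 1 = absLength (reflections n) w) :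
    ∃ x y, x ≠ y ∧ refl x y ≤ w ∧ u = w * refl x y := by
  have h1 := le_iff_absLength.1 hu
  obtain ⟨x, y, hxy, h⟩ := exists_refl_of_absLength_eq_one (w := u⁻¹ * w) (by omega)
  refine ⟨x, y, hxy, h ▸ inv_mul_le hu, ?_⟩
  rw [← refl_inv, ← h]
  simp

/-- The rank-four computation, transported along `emb v`. Since `w` moves only the indices in `v`,
each coatom is `w` times a reflection in these indices. -/
theorem coatoms_full_support {v : Fin 4 → SignedIdx n}
    (hv : Function.Injective fun i => (v i).1) {w : B n}
    (hw : ∀ z, (∀ i, z.1 ≠ (v i).1) → w.1 z = z)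
    (hbal : ∀ i, w.1.SameCycle (v i) (opp (v i))) (hD : ¬ AboveDoubleTwoCycle w) {u m : B n}
    (hu : u ≤ w) (hm : m ≤ w) (hne : u ≠ m)
    (hul : absLength (reflections n) u + 1 = absLength (reflections n) w)
    (hml : absLength (reflections n) m + 1 = absLength (reflections n) w)
    (hu1 : refl (v 0) (v 1) ≤ u) (hu2 : refl (v 2) (v 3) ≤ u)
    (hm1 : refl (v 0) (v 1) ≤ m) (hm2 : refl (v 2) (v 3) ≤ m) :
    refl (v 2) (v 3) ≤ refl (v 0) (v 1) * w := by
  obtain ⟨g, hg⟩ := exists_actsAs hv hw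
  -- If `w` fixed `x`, then `vec x` would be a fixed vector distinguishing `x` from `y`.
  have hmem : ∀ {x y}, x ≠ y → refl x y ≤ w → ∃ i, x.1 = (v i).1 := by
    intro x y hxy h
    by_contra! h'
    have h1 := refl_le_iff.1 h (vec x) (vec_mem_fixedSpace_rep.2 (hw x h'))
    have h2 := coord_vec_lt_one hxy.symm
    rw [← h1, coord_vec_self] at h2
    exact lt_irrefl _ h2
  have hcoatom : ∀ {u}, u ≤ w →
      absLength (reflections n) u + 1 = absLength (reflections n) w →
      ∃ x y : SignedIdx 4, x ≠ y ∧ u = w * refl (emb v x) (emb v y) := by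
    intro u hu hul
    obtain ⟨x, y, hxy, hle, h⟩ := eq_mul_refl_of_coatom hu hul
    obtain ⟨x, rfl⟩ := exists_emb_eq (hmem hxy hle)
    obtain ⟨y, rfl⟩ := exists_emb_eq (hmem hxy.symm (refl_comm _ y ▸ hle))
    exact ⟨x, y, fun h => hxy (by rw [h]), h⟩
  obtain ⟨x, y, hxy, rfl⟩ := hcoatom hu hul
  obtain ⟨x', y', hxy', rfl⟩ := hcoatom hm hml
  have a1 := hg.mul (actsAs_refl hv x y)
  have a2 := hg.mul (actsAs_refl hv x' y')
  have a3 := (actsAs_refl hv (0, 1) (1, 1)).mul hg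
  simp only [← emb_one v] at hu1 hu2 hm1 hm2 hbal ⊢
  rw [a1.refl_le_iff hv] at hu1 hu2
  rw [a2.refl_le_iff hv] at hm1 hm2
  rw [a3.refl_le_iff hv]
  refine refl_le_refl_mul_of_coatoms ?_ ?_ hxy hxy' ?_ hu1 hu2 hm1 hm2
  · intro z
    obtain ⟨i, e⟩ := z
    have h := hbal i
    rw [← emb_opp, hg.sameCycle_iff hv] at h
    rcases Int.units_eq_one_or e with rfl | rfl
    · exact h
    · exact sameCycle_opp h
  · by_contra! h
    exact hD (aboveDoubleTwoCycle_of_actsAs hv hw hg h)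
  · intro h
    apply hne
    congr 1
    apply ext_apply
    intro z
    by_cases hz : ∃ i, z.1 = (v i).1
    · obtain ⟨z, rfl⟩ := exists_emb_eq hz
      rw [actsAs_refl hv, actsAs_refl hv, h]
    · push Not at hz
      have fix : ∀ x y, (refl (emb v x) (emb v y)).1 z = z := fun x y =>
        refl_apply_of_fst_ne (hz x.1) (hz y.1)
      rw [fix, fix]

/-! ### Joins of reflections -/

/-- Distinct reflections below `u` have distinct fixed hyperplanes, so their intersection has
codimension at least two, as much as `u` allows. -/
theorem fixedSpace_eq_inf_of_absLength_le_two {t s u : B n}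
    (ht : absLength (reflections n) t = 1) (hs : absLength (reflections n) s = 1) (hts : t ≠ s)
    (hut : t ≤ u) (hus : s ≤ u) (hlen : absLength (reflections n) u ≤ 2) :
    fixedSpace (rep u) = fixedSpace (rep t) ⊓ fixedSpace (rep s) := by
  have hlt : fixedSpace (rep t) ⊓ fixedSpace (rep s) < fixedSpace (rep t) := by
    rw [inf_lt_left]
    intro h
    have h1 := le_of_fixedSpace_le hus hut h
    exact hts (eq_of_le_of_absLength_le h1 (by omega)).symm
  have h1 := Submodule.finrank_lt_finrank_of_lt hlt
  have h2 := finrank_fixedSpace_add (rep t)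
  have h3 := finrank_fixedSpace_add (rep u)
  rw [absLength_eq_codimFixed] at ht hlen
  exact Submodule.eq_of_le_of_finrank_le
    (le_inf (fixedSpace_le_of_le hut) (fixedSpace_le_of_le hus)) (by omega)

/-- An upper bound of length two of two distinct reflections is their join. -/
theorem le_of_absLength_le_two {t s u m w : B n} (ht : absLength (reflections n) t = 1)
    (hs : absLength (reflections n) s = 1) (hts : t ≠ s) (hu : u ≤ w) (hm : m ≤ w) (hut : t ≤ u)
    (hus : s ≤ u) (hmt : t ≤ m) (hms : s ≤ m) (hlen : absLength (reflections n) u ≤ 2) :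
    u ≤ m := by
  apply le_of_fixedSpace_le hu hm
  rw [fixedSpace_eq_inf_of_absLength_le_two ht hs hts hut hus hlen]
  exact le_inf (fixedSpace_le_of_le hmt) (fixedSpace_le_of_le hms)

theorem finrank_span_coordinates (D : Finset (Fin n)) :
    finrank ℝ (Submodule.span ℝ ((fun i => vec (i, 1)) '' (D : Set (Fin n)))) = D.card := by
  have h1 : LinearIndependent ℝ fun i : D => (vec (i.1, 1) : EuclideanSpace ℝ (Fin n)) := by
    have h : (fun i : D => (vec (i.1, 1) : EuclideanSpace ℝ (Fin n))) =
        (EuclideanSpace.basisFun (Fin n) ℝ).toBasis ∘ fun i : D => i.1 := by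
      funext i
      simp [vec]
    rw [h]
    exact (EuclideanSpace.basisFun (Fin n) ℝ).toBasis.linearIndependent.comp _
      Subtype.val_injective
  have h2 := finrank_span_eq_card h1
  rw [Fintype.card_coe] at h2
  rw [← h2, Set.image_eq_range]
  rfl

theorem coord_eq_zero_of_mem_span {D : Finset (Fin n)} {f : EuclideanSpace ℝ (Fin n)}
    (hf : f ∈ Submodule.span ℝ ((fun i => vec (i, 1)) '' (D : Set (Fin n)))) {x : SignedIdx n}
    (hx : x.1 ∉ D) : coord x f = 0 := by
  induction hf using Submodule.span_induction with
  | mem f h =>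
    obtain ⟨i, hi, rfl⟩ := h
    exact coord_vec_of_fst_ne fun h => hx (h ▸ hi)
  | zero => simp [coord]
  | add f g _ _ hf hg => rw [coord_add, hf, hg, add_zero]
  | smul c f _ hf => rw [coord_smul, hf, mul_zero]

theorem span_coordinates_le_fixedSpace_refl {D : Finset (Fin n)} {x y : SignedIdx n}
    (hx : x.1 ∉ D) (hy : y.1 ∉ D) :
    Submodule.span ℝ ((fun i => vec (i, 1)) '' (D : Set (Fin n))) ≤
      fixedSpace (rep (refl x y)) := by
  intro f hf
  rw [mem_fixedSpace_refl, coord_eq_zero_of_mem_span hf hx, coord_eq_zero_of_mem_span hf hy]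

/-- Any two reflections below an element that is not above a product of two balanced two-cycles
have a join below this element. -/
theorem exists_join_refl {w : B n} (hD : ¬ AboveDoubleTwoCycle w) {p q r s : SignedIdx n}
    (hpq : p ≠ q) (hrs : r ≠ s) (h1 : refl p q ≤ w) (h2 : refl r s ≤ w) :
    ∃ j ≤ w, refl p q ≤ j ∧ refl r s ≤ j ∧
      ∀ m ≤ w, refl p q ≤ m → refl r s ≤ m → j ≤ m := by
  by_cases heq : refl p q = refl r s
  · exact ⟨refl p q, h1, le_rfl, heq.ge, fun m _ h _ => h⟩
  -- Erasing all coordinates outside `S` takes upper bounds of the two reflections to upper bounds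
  -- below `w₀`, so the join may be sought below `w₀`, whose length is at most four.
  set S : Finset (Fin n) := {p.1, q.1, r.1, s.1} with hS
  have hp : p.1 ∉ Sᶜ := by simp [hS]
  have hq : q.1 ∉ Sᶜ := by simp [hS]
  have hr : r.1 ∉ Sᶜ := by simp [hS]
  have hs : s.1 ∉ Sᶜ := by simp [hS]
  obtain ⟨w₀, hw₀, hfix, -⟩ := exists_restrict w Sᶜ
  have hrestr : ∀ m ≤ w, refl p q ≤ m → refl r s ≤ m →
      ∃ m₀ ≤ m, m₀ ≤ w₀ ∧ refl p q ≤ m₀ ∧ refl r s ≤ m₀ := by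
    intro m hm hm1 hm2
    obtain ⟨m₀, hm₀, hfix', -⟩ := exists_restrict m Sᶜ
    refine ⟨m₀, hm₀, le_of_fixedSpace_le (hm₀.trans hm) hw₀ ?_,
      le_of_fixedSpace_le hm1 hm₀ ?_, le_of_fixedSpace_le hm2 hm₀ ?_⟩
    · rw [hfix, hfix']
      exact sup_le_sup_right (fixedSpace_le_of_le hm) _
    · rw [hfix']
      exact sup_le (fixedSpace_le_of_le hm1) (span_coordinates_le_fixedSpace_refl hp hq)
    · rw [hfix']
      exact sup_le (fixedSpace_le_of_le hm2) (span_coordinates_le_fixedSpace_refl hr hs)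
  suffices h : ∃ j ≤ w₀, refl p q ≤ j ∧ refl r s ≤ j ∧
      ∀ m ≤ w₀, refl p q ≤ m → refl r s ≤ m → j ≤ m by
    obtain ⟨j, hj1, hj2, hj3, hj4⟩ := h
    refine ⟨j, hj1.trans hw₀, hj2, hj3, fun m hm hm1 hm2 => ?_⟩
    obtain ⟨m₀, h3, h4, h5, h6⟩ := hrestr m hm hm1 hm2
    exact (hj4 m₀ h4 h5 h6).trans h3
  obtain ⟨m₀, -, h4, h5, h6⟩ := hrestr w le_rfl h1 h2
  have hw1 : refl p q ≤ w₀ := h5.trans h4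
  have hw2 : refl r s ≤ w₀ := h6.trans h4
  by_cases htwo : ∃ u ≤ w₀, refl p q ≤ u ∧ refl r s ≤ u ∧ absLength (reflections n) u ≤ 2
  · obtain ⟨u, hu, hu1, hu2, hu3⟩ := htwo
    exact ⟨u, hu, hu1, hu2, fun m hm hm1 hm2 => le_of_absLength_le_two (absLength_refl hpq)
      (absLength_refl hrs) heq hu hm hu1 hu2 hm1 hm2 hu3⟩
  push Not at htwo
  have hSc : Sᶜ.card + S.card = n := by
    rw [add_comm, Finset.card_add_card_compl, Fintype.card_fin]
  have hS4 : S.card ≤ 4 := Finset.card_le_four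
  have hspan : Submodule.span ℝ ((fun i => vec (i, 1)) '' ((Sᶜ : Finset _) : Set (Fin n))) ≤
      fixedSpace (rep w₀) := by
    rw [hfix]
    exact le_sup_right
  have hcard := finrank_span_coordinates (Sᶜ : Finset (Fin n))
  have hdim := Submodule.finrank_mono hspan
  have hcodim := finrank_fixedSpace_add (rep w₀)
  rw [← absLength_eq_codimFixed, finrank_euclideanSpace_fin] at hcodim
  by_cases hthree : ∃ u ≤ w₀, refl p q ≤ u ∧ refl r s ≤ u ∧ absLength (reflections n) u ≤ 3 ∧
      u ≠ w₀
  swap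
  -- Here `w₀` is the only upper bound: anything of length four or more below it equals it.
  · push Not at hthree
    refine ⟨w₀, le_rfl, hw1, hw2, fun m hm hm1 hm2 => ?_⟩
    by_cases hm3 : absLength (reflections n) m ≤ 3
    · exact (hthree m hm hm1 hm2 hm3).ge
    · exact (eq_of_le_of_absLength_le hm (by omega)).ge
  obtain ⟨u, hu, hu1, hu2, hu3, hne⟩ := hthree
  have hu4 := htwo u hu hu1 hu2
  have hw4 : absLength (reflections n) w₀ = 4 := by
    by_contra h
    exact hne (eq_of_le_of_absLength_le hu (by omega))
  refine ⟨u, hu, hu1, hu2, fun m hm hm1 hm2 => ?_⟩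
  have hm4 := htwo m hm hm1 hm2
  by_cases hm3 : absLength (reflections n) m ≤ 3
  swap
  · rw [eq_of_le_of_absLength_le hm (by omega)]
    exact hu
  by_contra hum
  -- Length four forces `S` to have four elements and the fixed space to be the span of the other
  -- coordinates, so all four lie on balanced cycles.
  have hfix' := Submodule.eq_of_le_of_finrank_le hspan (by omega)
  set v : Fin 4 → SignedIdx n := ![p, q, r, s] with hvdef
  have hvS : Finset.univ.image (fun i => (v i).1) = S := by
    ext i
    simp [hS, hvdef, Fin.exists_fin_succ, eq_comm]
  have hv : Function.Injective fun i => (v i).1 := by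
    have h : Set.InjOn (fun i => (v i).1) (Finset.univ : Finset (Fin 4)) := by
      rw [← Finset.card_image_iff, hvS, Finset.card_univ, Fintype.card_fin]
      omega
    rwa [Finset.coe_univ, Set.injOn_univ] at h
  have hwfix : ∀ z, (∀ i, z.1 ≠ (v i).1) → w₀.1 z = z := by
    intro z hz
    have hzS : z.1 ∈ Sᶜ := by
      rw [← hvS]
      simpa [eq_comm] using hz
    have h : vec (z.1, 1) ∈ fixedSpace (rep w₀) :=
      hspan (Submodule.subset_span ⟨z.1, by simpa using hzS, rfl⟩)
    rcases fst_eq_iff.1 (show z.1 = ((z.1, 1) : SignedIdx n).1 from rfl) with h' | h'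
    · rw [h']
      exact vec_mem_fixedSpace_rep.1 h
    · rw [h', apply_opp, vec_mem_fixedSpace_rep.1 h]
  have hbal : ∀ i, w₀.1.SameCycle (v i) (opp (v i)) := by
    intro i
    rw [sameCycle_opp_iff, ← hfix']
    intro f hf
    apply coord_eq_zero_of_mem_span hf
    rw [← hvS]
    simp
  have hkey : refl r s ≤ refl p q * w₀ :=
    coatoms_full_support hv hwfix hbal (fun h => hD (h.mono hw₀)) hu hm
      -- The resulting relation puts `refl p q * refl r s` below `w₀` as an upper bound of length at
      -- most two, contrary to `htwo`.
      (fun h => hum h.le) (by omega) (by omega) hu1 hu2 hm1 hm2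
  have h7 := le_mul_of_le_inv_mul (s := refl r s) hw1 (by rwa [refl_inv])
  have h8 : refl r s ≤ refl p q * refl r s := by
    simpa using inv_mul_le h7.1
  have h9 := htwo _ h7.2 h7.1 h8
  have h10 := absLength_mul_le (exists_list_reflections n) (refl p q) (refl r s)
  rw [absLength_refl hpq, absLength_refl hrs] at h10
  omega

/-! ### From joins of reflections to the lattice property -/

theorem isLatticePoset_Icc {w : B n} (hD : ¬ AboveDoubleTwoCycle w) :
    IsLatticePoset (Set.Icc (1 : B n) w) := by
  have hbot : ∀ x : Set.Icc (1 : B n) w, (⟨1, le_rfl, one_le_B w⟩ : Set.Icc (1 : B n) w) ≤ x :=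
    fun x => one_le_B x.1
  let : OrderBot (Set.Icc (1 : B n) w) := { bot := ⟨1, le_rfl, one_le_B w⟩, bot_le := hbot }
  apply isLatticePoset_of_exists_isLUB
  intro x y
  -- The steps above `z` are `z * t` with `t` a reflection below `z⁻¹ * w`. Their joins are
  -- translates by `z` of joins of reflections, and `z⁻¹ * w ≤ w` inherits the absence of the
  -- obstruction.
  refine exists_isLUB_of_local
    (fun z x => ∃ p q, p ≠ q ∧ refl p q ≤ z.1⁻¹ * w ∧ x.1 = z.1 * refl p q)
    ?_ ?_ ⊥ x y bot_le bot_le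
  · intro z x hzx
    have hne : z.1⁻¹ * x.1 ≠ 1 := by
      rw [Ne, inv_mul_eq_one]
      exact fun h => hzx.ne (Subtype.ext h)
    obtain ⟨p, q, hpq, hle⟩ := exists_refl_le hne
    have h1 := le_mul_of_le_inv_mul (Subtype.coe_le_coe.2 hzx.le) hle
    have h2 : z.1⁻¹ * x.1 ≤ z.1⁻¹ * w :=
      (inv_mul_le_inv_mul_iff (Subtype.coe_le_coe.2 hzx.le) z.2.2).2 x.2.2
    refine ⟨⟨z.1 * refl p q, one_le_B _, h1.2.trans x.2.2⟩, ⟨p, q, hpq, hle.trans h2, rfl⟩, ?_,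
      h1.2⟩
    refine lt_of_le_of_ne h1.1 fun h => ?_
    have h3 : refl p q = 1 := by simpa using congrArg Subtype.val h
    have h4 := absLength_refl hpq
    rw [h3, absLength_one] at h4
    exact zero_ne_one h4
  · rintro z x y ⟨p, q, hpq, h1, hx⟩ ⟨r, s, hrs, h2, hy⟩
    have hD' : ¬ AboveDoubleTwoCycle (z.1⁻¹ * w) := fun h => hD (h.mono (inv_mul_le z.2.2))
    obtain ⟨j, hj, hj1, hj2, hj3⟩ := exists_join_refl hD' hpq hrs h1 h2
    have hzx := (le_mul_of_le_inv_mul z.2.2 h1).1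
    have hzy := (le_mul_of_le_inv_mul z.2.2 h2).1
    have hzj := le_mul_of_le_inv_mul z.2.2 hj
    refine ⟨⟨z.1 * j, one_le_B _, hzj.2⟩, ?_, fun m hm => ?_⟩
    · rintro _ (rfl | rfl)
      · rw [← Subtype.coe_le_coe, hx, ← inv_mul_le_inv_mul_iff hzx hzj.1]
        simpa using hj1
      · rw [← Subtype.coe_le_coe, hy, ← inv_mul_le_inv_mul_iff hzy hzj.1]
        simpa using hj2
    · have hmx : x.1 ≤ m.1 := hm (by simp)
      have hmy : y.1 ≤ m.1 := hm (by simp)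
      rw [hx] at hmx
      rw [hy] at hmy
      have hzm := hzx.trans hmx
      rw [← Subtype.coe_le_coe, ← inv_mul_le_inv_mul_iff hzj.1 hzm, inv_mul_cancel_left]
      apply hj3
      · exact (inv_mul_le_inv_mul_iff hzm z.2.2).2 m.2.2
      · rw [← inv_mul_le_inv_mul_iff hzx hzm] at hmx
        simpa using hmx
      · rw [← inv_mul_le_inv_mul_iff hzy hzm] at hmy
        simpa using hmy

end DoubleTwoCycle

/-! ### Intervals that are not lattices -/

section NotLattice

variable {n : ℕ}

theorem coord_vec_nonpos {x y : SignedIdx n} (h : x ≠ y) : coord x (vec y) ≤ 0 := by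
  by_cases h1 : x.1 = y.1
  · rcases fst_eq_iff.1 h1 with rfl | rfl
    · exact absurd rfl h
    · rw [coord_vec_opp]
      norm_num
  · rw [coord_vec_of_fst_ne h1]

/-- Along `j a`, the image of `vec a + vec c` has coordinate `1`, whereas the sum itself has a
positive coordinate only at `a` and `c`. -/
theorem apply_eq_of_add_mem_fixedSpace {j : B n} {a c : SignedIdx n} (hac : a.1 ≠ c.1)
    (h : vec a + vec c ∈ fixedSpace (rep j)) (ha : j.1 a ≠ a) : j.1 a = c ∧ j.1 c = a := by
  rw [mem_fixedSpace, map_add, rep_vec, rep_vec] at h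
  have h1 : j.1 a = c := by
    by_contra hc
    have h1 := congrArg (coord (j.1 a)) h
    rw [coord_add, coord_add, coord_vec_self, coord_vec_of_fst_ne] at h1
    · have h2 := coord_vec_nonpos ha
      have h3 := coord_vec_nonpos hc
      linarith
    · rwa [Ne, fst_apply_eq_iff]
  rw [h1, add_comm, add_left_inj] at h
  exact ⟨h1, vec_injective h⟩

theorem sameCycle_apply (w : B n) (x : SignedIdx n) : w.1.SameCycle x (w.1 x) :=
  Equiv.Perm.sameCycle_apply_right.2 (Equiv.Perm.SameCycle.refl _ _)

theorem sameCycle_apply_apply (w : B n) (x : SignedIdx n) : w.1.SameCycle x (w.1 (w.1 x)) :=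
  (sameCycle_apply w x).trans (sameCycle_apply w _)

theorem mul_refl_le {w : B n} {x y : SignedIdx n} (h : refl x y ≤ w) : w * refl x y ≤ w := by
  simpa [refl_inv] using mul_inv_le h

theorem absLength_mul_refl {w : B n} {x y : SignedIdx n} (hxy : x ≠ y) (h : refl x y ≤ w) :
    absLength (reflections n) (w * refl x y) + 1 = absLength (reflections n) w := by
  have h1 := le_iff_absLength.1 (mul_refl_le h)
  rwa [mul_inv_rev, inv_mul_cancel_right, refl_inv, absLength_refl hxy] at h1

theorem IsDoubleTwoCycle.absLength_le_four {u : B n} {a c : SignedIdx n}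
    (h : IsDoubleTwoCycle u a c) : absLength (reflections n) u ≤ 4 := by
  obtain ⟨-, -, -, -, hfix⟩ := h
  set S : Finset (Fin n) := {a.1, (u.1 a).1, c.1, (u.1 c).1} with hS
  have hspan : Submodule.span ℝ ((fun i => vec (i, 1)) '' ((Sᶜ : Finset _) : Set (Fin n))) ≤
      fixedSpace (rep u) := by
    rw [Submodule.span_le]
    rintro _ ⟨i, hi, rfl⟩
    simp only [hS, Finset.coe_compl, Set.mem_compl_iff, Finset.mem_coe, Finset.mem_insert,
      Finset.mem_singleton, not_or] at hi
    exact vec_mem_fixedSpace_rep.2 (hfix (i, 1) hi.1 hi.2.1 hi.2.2.1 hi.2.2.2)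
  have h1 := Submodule.finrank_mono hspan
  have h2 := finrank_fixedSpace_add (rep u)
  have h3 := finrank_span_coordinates (Sᶜ : Finset (Fin n))
  have h4 : Sᶜ.card + S.card = n := by
    rw [add_comm, Finset.card_add_card_compl, Fintype.card_fin]
  have h5 : S.card ≤ 4 := Finset.card_le_four
  rw [← absLength_eq_codimFixed, finrank_euclideanSpace_fin] at h2
  omega

/-- With `b = u a` and `d = u c`, the witnesses are `((a, c))`, `((b, d))` and the coatoms `((a, b,
c, d))`, `((a, -d, c, -b))`. An element between would have length at most two, hence be `((a, c))
((b, d))`; but its complement in `u` is `[a, d] [c, b]`, of full length, which forces the element to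
be trivial. -/
theorem IsDoubleTwoCycle.exists_no_join {u : B n} {a c : SignedIdx n}
    (h : IsDoubleTwoCycle u a c) : ∃ t s u₁ u₂ : B n, t ≤ u₁ ∧ t ≤ u₂ ∧ s ≤ u₁ ∧ s ≤ u₂ ∧
      u₁ ≤ u ∧ u₂ ≤ u ∧ ∀ j, t ≤ j → s ≤ j → j ≤ u₁ → ¬ j ≤ u₂ := by
  have hlen := h.absLength_le_four
  obtain ⟨ha, hc, hca, hcb, hfix⟩ := h
  set b := u.1 a with hb
  set d := u.1 c with hd
  have hba : b.1 ≠ a.1 := fst_apply_ne ha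
  have hdc : d.1 ≠ c.1 := fst_apply_ne hc
  have hdb : d.1 ≠ b.1 := by rwa [hb, hd, Ne, fst_apply_eq_iff]
  have hda : d.1 ≠ a.1 := by
    rw [← fst_opp a, ← ha, hd, Ne, fst_apply_eq_iff]
    exact hcb
  have hbal_a : u.1.SameCycle a (opp a) := ha ▸ sameCycle_apply_apply u a
  have hbal_c : u.1.SameCycle c (opp c) := hc ▸ sameCycle_apply_apply u c
  have hbal_b : u.1.SameCycle b (opp b) := by
    have h := sameCycle_apply_apply u b
    rwa [ha, apply_opp] at h
  have hbal_d : u.1.SameCycle d (opp d) := by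
    have h := sameCycle_apply_apply u d
    rwa [hc, apply_opp] at h
  have hr1 : refl b (opp d) ≤ u := refl_le_iff_sameCycle.2 (Or.inr ⟨hbal_b, sameCycle_opp hbal_d⟩)
  have hr2 : refl a (opp c) ≤ u := refl_le_iff_sameCycle.2 (Or.inr ⟨hbal_a, sameCycle_opp hbal_c⟩)
  have hne : ∀ {x y : SignedIdx n}, x.1 ≠ y.1 → x ≠ y := fun h h' => h (by rw [h'])
  have e1 : (u * refl b (opp d)).1 a = b := by
    rw [mul_apply, refl_apply_of_fst_ne (y := opp d) hba.symm hda.symm]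
  have e2 : (u * refl b (opp d)).1 b = c := by
    rw [mul_apply, refl_apply_left, apply_opp, hc, opp_opp]
  have e3 : (u * refl b (opp d)).1 c = d := by
    rw [mul_apply, refl_apply_of_fst_ne (y := opp d) hcb hdc.symm]
  have e4 : (u * refl a (opp c)).1 a = opp d := by
    rw [mul_apply, refl_apply_left, apply_opp]
  have e5 : (u * refl a (opp c)).1 (opp d) = c := by
    rw [mul_apply, refl_apply_of_fst_ne (y := opp c) (z := opp d) hda hdc, apply_opp, hc, opp_opp]
  have e6 : (u * refl a (opp c)).1 b = opp a := by
    rw [mul_apply, refl_apply_of_fst_ne (y := opp c) hba hcb.symm, ha]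
  have e7 : (u * refl a (opp c)).1 (opp a) = d := by
    rw [apply_opp, e4, opp_opp]
  refine ⟨refl a c, refl b d, u * refl b (opp d), u * refl a (opp c), ?_, ?_, ?_, ?_,
    mul_refl_le hr1, mul_refl_le hr2, fun j hj1 hj2 hj3 hj4 => ?_⟩
  · refine refl_le_iff_sameCycle.2 (Or.inl ?_)
    have h := sameCycle_apply_apply (u * refl b (opp d)) a
    rwa [e1, e2] at h
  · refine refl_le_iff_sameCycle.2 (Or.inl ?_)
    have h := sameCycle_apply_apply (u * refl a (opp c)) a
    rwa [e4, e5] at h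
  · refine refl_le_iff_sameCycle.2 (Or.inl ?_)
    have h := sameCycle_apply_apply (u * refl b (opp d)) b
    rwa [e2, e3] at h
  · refine refl_le_iff_sameCycle.2 (Or.inl ?_)
    have h := sameCycle_apply_apply (u * refl a (opp c)) b
    rwa [e6, e7] at h
  have l1 := absLength_mul_refl (hne (y := opp d) hdb.symm) hr1
  have l2 := absLength_mul_refl (hne (y := opp c) hca.symm) hr2
  -- Both coatoms have length at most three, so a longer `j` would equal both, and they differ at
  -- `a`.
  have hjlen : absLength (reflections n) j ≤ 2 := by
    by_contra hj
    have h1 := eq_of_le_of_absLength_le hj3 (by omega)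
    have h2 := eq_of_le_of_absLength_le hj4 (by omega)
    have h3 : b = opp d := e1.symm.trans ((DFunLike.congr_fun (congrArg Subtype.val
      (h1.symm.trans h2)) a).trans e4)
    exact hdb.symm (by rw [h3, fst_opp])
  have hts : refl a c ≠ refl b d := by
    intro h
    have h1 : (refl a c).1 a = (refl b d).1 a := by rw [h]
    rw [refl_apply_left, refl_apply_of_fst_ne hba.symm hda.symm] at h1
    exact hne hca h1
  have hjfix := fixedSpace_eq_inf_of_absLength_le_two (absLength_refl (hne hca.symm))
    (absLength_refl (hne hdb.symm)) hts hj1 hj2 hjlen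
  have hvec : ∀ {p q : SignedIdx n}, p.1 ≠ q.1 → vec p + vec q ∈ fixedSpace (rep (refl p q)) := by
    intro p q hpq
    rw [mem_fixedSpace, map_add, rep_vec, rep_vec, refl_apply_left, refl_apply_right, add_comm]
  have hvec' : ∀ {p q r s : SignedIdx n}, p.1 ≠ r.1 → p.1 ≠ s.1 → q.1 ≠ r.1 → q.1 ≠ s.1 →
      vec p + vec q ∈ fixedSpace (rep (refl r s)) := by
    intro p q r s h1 h2 h3 h4
    rw [mem_fixedSpace, map_add, rep_vec, rep_vec, refl_apply_of_fst_ne h1 h2,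
      refl_apply_of_fst_ne h3 h4]
  have hmove : ∀ {x : SignedIdx n}, j.1 x = x → (refl a c).1 x = x ∧ (refl b d).1 x = x := by
    intro x hx
    rw [← vec_mem_fixedSpace_rep, hjfix] at hx
    exact ⟨vec_mem_fixedSpace_rep.1 hx.1, vec_mem_fixedSpace_rep.1 hx.2⟩
  obtain ⟨ja, jc⟩ : j.1 a = c ∧ j.1 c = a := by
    refine apply_eq_of_add_mem_fixedSpace hca.symm ?_ fun h => ?_
    · rw [hjfix]
      exact ⟨hvec hca.symm, hvec' hba.symm hda.symm hcb hdc.symm⟩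
    · have h1 := (hmove h).1
      rw [refl_apply_left] at h1
      exact hne hca h1
  obtain ⟨jb, jd⟩ : j.1 b = d ∧ j.1 d = b := by
    refine apply_eq_of_add_mem_fixedSpace hdb.symm ?_ fun h => ?_
    · rw [hjfix]
      exact ⟨hvec' hba hcb.symm hda hdc, hvec hdb.symm⟩
    · have h1 := (hmove h).2
      rw [refl_apply_left] at h1
      exact hne hdb h1
  have hju := hj3.trans (mul_refl_le hr1)
  have inv : ∀ {x y : SignedIdx n}, j.1 x = y → (j⁻¹).1 y = x := by
    rintro x _ rfl
    exact inv_apply_apply j x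
  have va : (j⁻¹ * u).1 a = d := by rw [mul_apply, ← hb, inv jd]
  have vd : (j⁻¹ * u).1 d = opp a := by rw [mul_apply, hc, apply_opp, inv ja]
  have vc : (j⁻¹ * u).1 c = b := by rw [mul_apply, ← hd, inv jb]
  have vb : (j⁻¹ * u).1 b = opp c := by rw [mul_apply, ha, apply_opp, inv jc]
  -- A vector fixed by `j⁻¹ * u` vanishes at `a`, `b`, `c`, `d`, and every other index is fixed by
  -- `u`; so it is fixed by `u`.
  have hEq : j⁻¹ * u = u := by
    apply eq_of_fixedSpace_le (inv_mul_le hju)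
    intro f hf
    have f1 := mem_fixedSpace_rep.1 hf
    have fa := f1 a
    have fb := f1 b
    have fc := f1 c
    have fd := f1 d
    rw [va] at fa
    rw [vb, coord_opp] at fb
    rw [vc] at fc
    rw [vd, coord_opp] at fd
    have za : coord a f = 0 := by linarith
    have zb : coord b f = 0 := by linarith
    have zc : coord c f = 0 := by linarith
    have zd : coord d f = 0 := by linarith
    have zero : ∀ {x z : SignedIdx n}, coord x f = 0 → z.1 = x.1 → coord z f = 0 := by
      intro x z hx hz
      rcases fst_eq_iff.1 hz with rfl | rfl
      · exact hx
      · rw [coord_opp, hx, neg_zero]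
    rw [mem_fixedSpace_rep]
    intro z
    by_cases h1 : z.1 = a.1
    · rw [zero za h1, zero zb (fst_apply_eq_iff.2 h1)]
    by_cases h2 : z.1 = b.1
    · rw [zero zb h2, zero za]
      rw [fst_apply_eq_iff.2 h2, ha, fst_opp]
    by_cases h3 : z.1 = c.1
    · rw [zero zc h3, zero zd (fst_apply_eq_iff.2 h3)]
    by_cases h4 : z.1 = d.1
    · rw [zero zd h4, zero zc]
      rw [fst_apply_eq_iff.2 h4, hc, fst_opp]
    rw [hfix z h1 h2 h3 h4]
  have hj : j = 1 := by simpa using hEq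
  rw [hj] at ja
  exact hne hca.symm ja

theorem not_isLatticePoset_Icc {w : B n} (h : AboveDoubleTwoCycle w) :
    ¬ IsLatticePoset (Set.Icc (1 : B n) w) := by
  obtain ⟨u, hu, a, c, hac⟩ := h
  obtain ⟨t, s, u₁, u₂, h1, h2, h3, h4, h5, h6, h7⟩ := hac.exists_no_join
  intro hL
  have hu₁ := h5.trans hu
  have hu₂ := h6.trans hu
  obtain ⟨⟨j, hj⟩, -⟩ := hL ⟨t, one_le_B t, h1.trans hu₁⟩ ⟨s, one_le_B s, h3.trans hu₁⟩
  have key : ∀ v, v ≤ w → t ≤ v → s ≤ v → j.1 ≤ v := by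
    intro v hv htv hsv
    have h : j ≤ ⟨v, one_le_B v, hv⟩ := by
      apply hj.2
      rintro _ (rfl | rfl)
      exacts [htv, hsv]
    exact h
  exact h7 j.1 (hj.1 (Set.mem_insert _ _)) (hj.1 (Set.mem_insert_of_mem _ rfl))
    (key u₁ hu₁ h1 h3) (key u₂ hu₂ h2 h4)

end NotLattice

/-! ### Hook partitions and balanced cycles -/

section Hook

variable {n : ℕ}

/-- All balanced cycles of length at least two coincide. -/
def AtMostOneLongBalanced (w : B n) : Prop :=
  ∀ x y, w.1.SameCycle x (opp x) → w.1.SameCycle y (opp y) → w.1 x ≠ opp x → w.1 y ≠ opp y →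
    w.1.SameCycle x y

theorem mem_span_coordinates {D : Finset (Fin n)} {f : EuclideanSpace ℝ (Fin n)}
    (hf : ∀ i ∉ D, f i = 0) :
    f ∈ Submodule.span ℝ ((fun i => vec (i, 1)) '' (D : Set (Fin n))) := by
  rw [← (EuclideanSpace.basisFun (Fin n) ℝ).sum_repr f]
  refine Submodule.sum_mem _ fun i _ => ?_
  by_cases hi : i ∈ D
  · refine Submodule.smul_mem _ _ (Submodule.subset_span ⟨i, hi, ?_⟩)
    simp [vec]
  · simp [hf i hi]

theorem sameCycle_subset {w : B n} {s : Set (SignedIdx n)} (hs : ∀ z ∈ s, w.1 z ∈ s)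
    {x y : SignedIdx n} (h : w.1.SameCycle x y) (hx : x ∈ s) : y ∈ s := by
  obtain ⟨k, rfl⟩ := h.exists_nat_pow_eq
  clear h
  induction k with
  | zero => exact hx
  | succ k ih =>
    rw [pow_succ', Equiv.Perm.mul_apply]
    exact hs _ ih

theorem fst_eq_of_sameCycle {w : B n} {x y : SignedIdx n} (hx : w.1 x = opp x)
    (h : w.1.SameCycle x y) : y.1 = x.1 := by
  refine sameCycle_subset (s := {z | z.1 = x.1}) (fun z hz => ?_) h rfl
  rcases fst_eq_iff.1 hz with rfl | rfl
  · change (w.1 z).1 = z.1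
    rw [hx, fst_opp]
  · change (w.1 (opp x)).1 = x.1
    rw [apply_opp, hx, opp_opp]

/-- Restricting `w` to the support of a double two-cycle `u ≤ w` gives an element with the fixed
space of `u`, hence `u` itself. Restriction keeps surviving indices of one cycle together, yet `u`
separates `a` from `c` while `w` cannot. -/
theorem not_aboveDoubleTwoCycle {w : B n} (hw : AtMostOneLongBalanced w) :
    ¬ AboveDoubleTwoCycle w := by
  rintro ⟨u, hu, a, c, ha, hc, hca, hcb, hfix⟩
  have hba := fst_apply_ne ha
  have hdc := fst_apply_ne hc
  set S : Finset (Fin n) := {a.1, (u.1 a).1, c.1, (u.1 c).1} with hS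
  obtain ⟨u', hu', hf, h3, -, h5⟩ := exists_restrict w Sᶜ
  have hzero : ∀ x, u.1.SameCycle x (opp x) → ∀ f ∈ fixedSpace (rep u), f x.1 = 0 := by
    intro x hx f hf
    have h := coord_eq_zero_of_sameCycle_opp hx hf
    obtain ⟨i, e⟩ := x
    rcases Int.units_eq_one_or e with rfl | rfl <;> simpa [coord] using h
  have hbal_a : u.1.SameCycle a (opp a) := ha ▸ sameCycle_apply_apply u a
  have hbal_c : u.1.SameCycle c (opp c) := hc ▸ sameCycle_apply_apply u c
  have hbal_ua : u.1.SameCycle (u.1 a) (opp (u.1 a)) := by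
    rw [← apply_opp, Equiv.Perm.sameCycle_apply_left, Equiv.Perm.sameCycle_apply_right]
    exact hbal_a
  have hbal_uc : u.1.SameCycle (u.1 c) (opp (u.1 c)) := by
    rw [← apply_opp, Equiv.Perm.sameCycle_apply_left, Equiv.Perm.sameCycle_apply_right]
    exact hbal_c
  have heq : u' = u := by
    refine eq_of_fixedSpace_le (le_of_fixedSpace_le hu' hu ?_) ?_ <;> rw [hf]
    · refine le_trans (fun f hf => mem_span_coordinates fun i hi => ?_) le_sup_right
      rw [Finset.mem_compl, not_not, hS] at hi
      simp only [Finset.mem_insert, Finset.mem_singleton] at hi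
      rcases hi with rfl | rfl | rfl | rfl
      · exact hzero _ hbal_a f hf
      · exact hzero _ hbal_ua f hf
      · exact hzero _ hbal_c f hf
      · exact hzero _ hbal_uc f hf
    · refine sup_le (fixedSpace_le_of_le hu) ?_
      rw [Submodule.span_le]
      rintro _ ⟨i, hi, rfl⟩
      simp only [hS, Finset.coe_compl, Set.mem_compl_iff, Finset.mem_coe, Finset.mem_insert,
        Finset.mem_singleton, not_or] at hi
      exact vec_mem_fixedSpace_rep.2 (hfix (i, 1) hi.1 hi.2.1 hi.2.2.1 hi.2.2.2)
  rw [heq] at h3 h5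
  have hbal : ∀ {x}, u.1.SameCycle x (opp x) → w.1.SameCycle x (opp x) := fun hx =>
    sameCycle_of_forall_apply h3 hx
  have hac : w.1.SameCycle a c := by
    -- If `w a = opp a`, the cycle of `a` under `w` is `±a`, but it contains `u a`; similarly for
    -- `c`.
    refine hw a c (hbal hbal_a) (hbal hbal_c) (fun h => hba ?_) (fun h => hdc ?_)
    · exact fst_eq_of_sameCycle h (h3 a)
    · exact fst_eq_of_sameCycle h (h3 c)
  have hac' := h5 a c (by simp [hS]) (by simp [hS]) hac
  have hmem : c ∈ {z : SignedIdx n | z.1 = a.1 ∨ z.1 = (u.1 a).1} := by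
    refine sameCycle_subset (fun z hz => ?_) hac' (Or.inl rfl)
    rcases hz with h | h
    · exact Or.inr (fst_apply_eq_iff.2 h)
    · refine Or.inl ?_
      rw [fst_apply_eq_iff.2 h, ha, fst_opp]
  exact hmem.elim hca hcb

/-- Keeping only two consecutive indices of each of two long balanced cycles of `w` leaves `[x, w x]
[y, w y]`. -/
theorem aboveDoubleTwoCycle_of_not {w : B n} (hw : ¬ AtMostOneLongBalanced w) :
    AboveDoubleTwoCycle w := by
  unfold AtMostOneLongBalanced at hw
  push Not at hw
  obtain ⟨x, y, hx, hy, hwx, hwy, hxy⟩ := hw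
  set S : Finset (Fin n) := {x.1, (w.1 x).1, y.1, (w.1 y).1} with hS
  obtain ⟨u, hu, hf, h3, h4, h5⟩ := exists_restrict w Sᶜ
  have hfix : ∀ z : SignedIdx n, z.1 ∉ S → u.1 z = z := by
    intro z hz
    have h : vec (z.1, 1) ∈ fixedSpace (rep u) := by
      rw [hf]
      exact Submodule.mem_sup_right (Submodule.subset_span ⟨z.1, by simpa using hz, rfl⟩)
    rcases fst_eq_iff.1 (show z.1 = ((z.1, 1) : SignedIdx n).1 from rfl) with h' | h'
    · rw [h']
      exact vec_mem_fixedSpace_rep.1 h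
    · rw [h', apply_opp, vec_mem_fixedSpace_rep.1 h]
  have hmemS : ∀ z : SignedIdx n, z.1 ∈ S → (u.1 z).1 ∈ S := by
    intro z hz
    by_contra h
    rw [u.1.injective (hfix _ h)] at h
    exact h hz
  have hxy' : ¬ w.1.SameCycle x (opp y) := fun h => hxy (h.trans hy.symm)
  have key : ∀ x y : SignedIdx n, x.1 ∈ S → (w.1 x).1 ∈ S →
      (∀ i ∈ S, i = x.1 ∨ i = (w.1 x).1 ∨ i = y.1 ∨ i = (w.1 y).1) →
      w.1.SameCycle x (opp x) → w.1 x ≠ opp x → ¬ w.1.SameCycle x y →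
      ¬ w.1.SameCycle x (opp y) → u.1 x = w.1 x ∧ u.1 (u.1 x) = opp x := by
    intro x y hxS hwxS hcover hx hwx hxy hxy'
    have hux : u.1 x = w.1 x := h4 x (by simpa using hxS) (by simpa using hwxS)
    refine ⟨hux, ?_⟩
    have hsame : w.1.SameCycle x (u.1 (u.1 x)) := by
      have h := h3 (u.1 x)
      rw [hux, Equiv.Perm.sameCycle_apply_left] at h
      rwa [hux]
    have hbal : u.1.SameCycle x (opp x) := h5 _ _ (by simpa using hxS) (by simpa [fst_opp] using hxS) hx
    have hne : u.1 x ≠ x := fun h => opp_ne x (hbal.eq_of_left h).symm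
    -- The value `u (u x)` stays in `S` and on the cycle of `x` under `w`, so it is `±x` or `±w x`;
    -- balancedness and injectivity leave only `opp x`.
    rcases hcover _ (hmemS _ (hux ▸ hwxS)) with h | h | h | h
    · rcases fst_eq_iff.1 h with h | h
      · have hmem : opp x ∈ ({x, u.1 x} : Set (SignedIdx n)) := by
          refine sameCycle_subset ?_ hbal (Or.inl rfl)
          rintro z (rfl | rfl)
          · exact Or.inr rfl
          · exact Or.inl h
        rcases hmem with h' | h'
        · exact absurd h' (opp_ne x)
        · rw [Set.mem_singleton_iff, hux] at h'
          exact absurd h'.symm hwx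
      · exact h
    · rw [← hux] at h
      rcases fst_eq_iff.1 h with h | h
      · exact absurd (u.1.injective h) hne
      · rw [← apply_opp] at h
        exact absurd (hux.symm.trans (u.1.injective h)) hwx
    · rcases fst_eq_iff.1 h with h | h
      · exact absurd (h ▸ hsame) hxy
      · exact absurd (h ▸ hsame) hxy'
    · rcases fst_eq_iff.1 h with h | h
      · rw [h, Equiv.Perm.sameCycle_apply_right] at hsame
        exact absurd hsame hxy
      · rw [h, ← apply_opp, Equiv.Perm.sameCycle_apply_right] at hsame
        exact absurd hsame hxy'
  obtain ⟨kx, kxx⟩ := key x y (by simp [hS]) (by simp [hS]) (by simp [hS]) hx hwx hxy hxy'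
  obtain ⟨ky, kyy⟩ := key y x (by simp [hS]) (by simp [hS]) (by simp [hS]) hy hwy
    (fun h => hxy h.symm) (fun h => hxy' (by simpa [opp_opp] using (sameCycle_opp h).symm))
  refine ⟨u, hu, x, y, kxx, kyy, fun h => ?_, fun h => ?_, fun z h1 h2 h3 h4 => hfix z ?_⟩
  · rcases fst_eq_iff.1 h with rfl | rfl
    · exact hxy (Equiv.Perm.SameCycle.refl _ _)
    · exact hxy' (by rw [opp_opp])
  · rw [kx] at h
    rcases fst_eq_iff.1 h with rfl | rfl
    · exact hxy (sameCycle_apply w x)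
    · exact hxy' (by rw [opp_opp]; exact sameCycle_apply w x)
  · rw [kx] at h2
    rw [ky] at h4
    simp [hS, h1, h2, h3, h4]

/-! ### Balanced cycles as factors -/

theorem nodup_append_map_opp {l : List (SignedIdx n)} (h : (l.map Prod.fst).Nodup) :
    (l ++ l.map opp).Nodup := by
  rw [List.nodup_append]
  refine ⟨h.of_map, h.of_map.map opp_injective, ?_⟩
  rintro x hx _ hy rfl
  obtain ⟨y, hy, hyx⟩ := List.mem_map.1 hy
  have h1 : y = x := List.inj_on_of_nodup_map h hy hx (by rw [← hyx, fst_opp])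
  rw [h1] at hyx
  exact opp_ne x hyx

/-- Take the least `k` with `w ^ k` sending `x` to `opp x`. The first `k` iterates have distinct
absolute values by minimality, and the next `k` are their opposites. -/
theorem exists_balancedCycle_eq_cycleOf {w : B n} {x : SignedIdx n}
    (hx : w.1.SameCycle x (opp x)) : IsBalancedCycle (w.1.cycleOf x) := by
  classical
  have hex : ∃ k : ℕ, (w.1 ^ k) x = opp x := hx.exists_nat_pow_eq
  set k := Nat.find hex with hk
  have hkx : (w.1 ^ k) x = opp x := Nat.find_spec hex
  have hmin : ∀ m < k, (w.1 ^ m) x ≠ opp x := fun m hm => Nat.find_min hex hm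
  have hk0 : k ≠ 0 := by
    intro h
    rw [h, pow_zero] at hkx
    exact opp_ne x hkx.symm
  have hpow : ∀ (m : ℕ) (z), (w.1 ^ m) (opp z) = opp ((w.1 ^ m) z) := fun m => apply_opp (w ^ m)
  -- An earlier return to `x` would let a smaller power reach `opp x`.
  have hret : ∀ m, 0 < m → m < k → (w.1 ^ m) x ≠ x := by
    intro m hm hmk h
    apply hmin (k - m) (by omega)
    have h1 : (w.1 ^ (k - m + m)) x = opp x := by rw [Nat.sub_add_cancel hmk.le, hkx]
    rwa [pow_add, Equiv.Perm.mul_apply, h] at h1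
  set l : List (SignedIdx n) := (List.range k).map fun i => (w.1 ^ i) x with hl
  have hnodup : (l.map Prod.fst).Nodup := by
    rw [hl, List.map_map]
    refine (List.nodup_map_iff_inj_on List.nodup_range).2 ?_
    have aux : ∀ i j, i < j → j < k → ((w.1 ^ i) x).1 ≠ ((w.1 ^ j) x).1 := by
      intro i j hij hj h
      have h1 : (w.1 ^ j) x = (w.1 ^ i) ((w.1 ^ (j - i)) x) := by
        rw [← Equiv.Perm.mul_apply, ← pow_add, Nat.add_sub_cancel' hij.le]
      rw [h1] at h
      rcases fst_eq_iff.1 h with h | h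
      · exact hret (j - i) (by omega) (by omega) ((w.1 ^ i).injective h).symm
      · rw [← hpow] at h
        have h2 : x = opp ((w.1 ^ (j - i)) x) := (w.1 ^ i).injective h
        exact hmin (j - i) (by omega) (opp_eq_iff.2 h2).symm
    intro i hi j hj h
    rw [List.mem_range] at hi hj
    rcases lt_trichotomy i j with hij | hij | hij
    · exact absurd h (aux i j hij hj)
    · exact hij
    · exact absurd h.symm (aux j i hij hi)
  refine ⟨l, ?_, hnodup, ?_⟩
  · rw [hl, Ne, List.map_eq_nil_iff, List.range_eq_nil]
    exact hk0
  have happ : l ++ l.map opp = (List.range (k + k)).map fun i => (w.1 ^ i) x := by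
    rw [List.range_add, List.map_append, List.map_map, hl, List.map_map]
    congr 1
    apply List.map_congr_left
    intro i _
    change opp ((w.1 ^ i) x) = (w.1 ^ (k + i)) x
    rw [add_comm, pow_add, Equiv.Perm.mul_apply, hkx, hpow]
  have hkk : (w.1 ^ (k + k)) x = x := by
    rw [pow_add, Equiv.Perm.mul_apply, hkx, hpow, hkx, opp_opp]
  have hnd := nodup_append_map_opp hnodup
  unfold balancedCycle
  rw [happ] at hnd ⊢
  apply Equiv.ext
  intro z
  rw [Equiv.Perm.cycleOf_apply]
  split_ifs with hz
  · obtain ⟨m, hm⟩ := hz.exists_nat_pow_eq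
    have hmod : (w.1 ^ (m % (k + k))) x = z := by
      rw [← hm, ← Equiv.Perm.iterate_eq_pow, ← Equiv.Perm.iterate_eq_pow]
      apply Function.IsPeriodicPt.iterate_mod_apply
      change w.1^[k + k] x = x
      rw [Equiv.Perm.iterate_eq_pow, hkk]
    set i := m % (k + k) with hi
    have hik : i < k + k := Nat.mod_lt _ (by omega)
    have h := List.formPerm_apply_getElem _ hnd i (by simpa using hik)
    simp only [List.getElem_map, List.getElem_range, List.length_map, List.length_range] at h
    rw [hmod] at h
    rw [h, ← hmod, ← Equiv.Perm.mul_apply, ← pow_succ']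
    rcases Nat.lt_or_ge (i + 1) (k + k) with h1 | h1
    · rw [Nat.mod_eq_of_lt h1]
    · have h2 : i + 1 = k + k := by omega
      rw [h2, Nat.mod_self, hkk, pow_zero, Equiv.Perm.one_apply]
  · rw [List.formPerm_apply_of_notMem]
    rw [List.mem_map]
    rintro ⟨i, -, rfl⟩
    exact hz ⟨i, by simp⟩

theorem exists_mem_balancedCycles {w : B n} {x : SignedIdx n} (hx : w.1.SameCycle x (opp x)) :
    ∃ c ∈ balancedCycles w, c.1 = w.1.cycleOf x := by
  classical
  have hodd : w.1.cycleOf x ∈ B n := by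
    intro z
    have h : w.1.SameCycle x (opp z) ↔ w.1.SameCycle x z := by
      constructor
      · intro h
        have h1 := sameCycle_opp h
        rw [opp_opp] at h1
        exact hx.trans h1
      · intro h
        exact hx.trans (sameCycle_opp h)
    rw [Equiv.Perm.cycleOf_apply, Equiv.Perm.cycleOf_apply]
    by_cases hz : w.1.SameCycle x z
    · rw [if_pos hz, if_pos (h.2 hz), apply_opp]
    · rw [if_neg hz, if_neg (mt h.1 hz)]
  refine ⟨⟨w.1.cycleOf x, hodd⟩, ?_, rfl⟩
  rw [balancedCycles, Finset.mem_filter]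
  refine ⟨Finset.mem_univ _, exists_balancedCycle_eq_cycleOf hx, ?_⟩
  rw [Equiv.Perm.cycleOf_mem_cycleFactorsFinset_iff, Equiv.Perm.mem_support]
  intro h
  exact opp_ne x (hx.eq_of_left h).symm

theorem exists_eq_cycleOf_of_mem_balancedCycles {w c : B n} (hc : c ∈ balancedCycles w) :
    ∃ x, c.1 = w.1.cycleOf x ∧ w.1.SameCycle x (opp x) := by
  classical
  rw [balancedCycles, Finset.mem_filter] at hc
  obtain ⟨-, -, hc⟩ := hc
  obtain ⟨hcyc, hcw⟩ := Equiv.Perm.mem_cycleFactorsFinset_iff.1 hc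
  obtain ⟨x, hx, -⟩ := id hcyc
  have hxs : x ∈ c.1.support := Equiv.Perm.mem_support.2 hx
  have hcx := Equiv.Perm.cycle_is_cycleOf hxs hc
  refine ⟨x, hcx, ?_⟩
  have hox : c.1 (opp x) ≠ opp x := by
    rw [apply_opp]
    exact opp_injective.ne hx
  have h := hcyc.sameCycle hx hox
  rw [hcx] at h
  obtain ⟨k, hk⟩ := h
  exact ⟨k, by rw [← Equiv.Perm.cycleOf_zpow_apply_self, hk]⟩

/-- An element of length one is an involution, so the cycle is contained in `{x, w x}` and `opp x`
must be `w x`. Thus parts equal to `1` in `mu w` are the cycles `[i]`. -/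
theorem absLength_eq_one_iff_of_eq_cycleOf {w c : B n} {x : SignedIdx n}
    (hc : c.1 = w.1.cycleOf x) (hx : w.1.SameCycle x (opp x)) :
    absLength (reflections n) c = 1 ↔ w.1 x = opp x := by
  have hcz : ∀ z, w.1.SameCycle x z → c.1 z = w.1 z := fun z hz => by
    rw [hc, hz.cycleOf_apply]
  constructor
  · intro h
    obtain ⟨p, q, -, rfl⟩ := exists_refl_of_absLength_eq_one h
    have h1 : (refl p q).1 ((refl p q).1 x) = x := reflFun_involutive p q x
    rw [hcz x (Equiv.Perm.SameCycle.refl _ _), hcz _ (sameCycle_apply w x)] at h1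
    have hmem : opp x ∈ ({x, w.1 x} : Set (SignedIdx n)) := by
      refine sameCycle_subset ?_ hx (Or.inl rfl)
      rintro z (rfl | rfl)
      · exact Or.inr rfl
      · exact Or.inl h1
    rcases hmem with h' | h'
    · exact absurd h' (opp_ne x)
    · exact h'.symm
  · intro h
    have heq : c = refl x (opp x) := by
      apply ext_apply
      intro z
      by_cases hz : w.1.SameCycle x z
      · rw [hcz z hz]
        rcases fst_eq_iff.1 (fst_eq_of_sameCycle h hz) with rfl | rfl
        · rw [h, refl_apply_left]
        · rw [apply_opp, h, opp_opp, refl_apply_right]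
      · rw [hc, Equiv.Perm.cycleOf_apply_of_not_sameCycle hz]
        have hne : z.1 ≠ x.1 := by
          intro h'
          rcases fst_eq_iff.1 h' with rfl | rfl
          · exact hz (Equiv.Perm.SameCycle.refl _ _)
          · exact hz hx
        rw [refl_apply_of_fst_ne (y := opp x) hne hne]
    rw [heq, absLength_refl (opp_ne x).symm]

theorem atMostOneLongBalanced_iff {w : B n} : AtMostOneLongBalanced w ↔
    ∀ c ∈ balancedCycles w, ∀ c' ∈ balancedCycles w, absLength (reflections n) c ≠ 1 →
      absLength (reflections n) c' ≠ 1 → c = c' := by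
  constructor
  · intro h c hc c' hc' h1 h1'
    obtain ⟨x, hx, hxx⟩ := exists_eq_cycleOf_of_mem_balancedCycles hc
    obtain ⟨y, hy, hyy⟩ := exists_eq_cycleOf_of_mem_balancedCycles hc'
    rw [Ne, absLength_eq_one_iff_of_eq_cycleOf hx hxx] at h1
    rw [Ne, absLength_eq_one_iff_of_eq_cycleOf hy hyy] at h1'
    apply Subtype.ext
    rw [hx, hy, (h x y hxx hyy h1 h1').cycleOf_eq]
  · intro h x y hx hy hwx hwy
    obtain ⟨c, hc, hcx⟩ := exists_mem_balancedCycles hx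
    obtain ⟨c', hc', hcy⟩ := exists_mem_balancedCycles hy
    rw [Ne, ← absLength_eq_one_iff_of_eq_cycleOf hcx hx] at hwx
    rw [Ne, ← absLength_eq_one_iff_of_eq_cycleOf hcy hy] at hwy
    have heq : w.1.cycleOf x = w.1.cycleOf y := by
      rw [← hcx, ← hcy, h c hc c' hc' hwx hwy]
    by_contra hxy
    have h1 := Equiv.Perm.cycleOf_apply_of_not_sameCycle hxy
    rw [heq, Equiv.Perm.cycleOf_apply_self] at h1
    exact opp_ne y (hy.eq_of_left h1).symm

/-! ### The hook condition as a statement about parts different from one -/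

theorem one_le_of_mem_parts_mu {w c : B n} (hc : c ∈ balancedCycles w) :
    1 ≤ absLength (reflections n) c :=
  (mu w).parts_pos (Multiset.mem_map.2 ⟨c, hc, rfl⟩)

/-- A finite family of positive integers forms the empty or a hook partition if and only if at most
one of them differs from `1`. -/
theorem map_val_eq_zero_or_hook_iff {α : Type*} (s : Finset α) (f : α → ℕ)
    (hf : ∀ c ∈ s, 1 ≤ f c) :
    (s.val.map f = 0 ∨ ∃ k r : ℕ, 1 ≤ k ∧ s.val.map f = k ::ₘ Multiset.replicate r 1) ↔
      ∀ c ∈ s, ∀ c' ∈ s, f c ≠ 1 → f c' ≠ 1 → c = c' := by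
  classical
  constructor
  · intro h c hc c' hc' h1 h1'
    have hcount : (s.val.map f).countP (fun i => i ≠ 1) ≤ 1 := by
      rcases h with h | ⟨k, r, -, h⟩
      · simp [h]
      · rw [h, Multiset.countP_cons,
          Multiset.countP_eq_zero.2 fun i hi => by simp [Multiset.eq_of_mem_replicate hi]]
        split_ifs <;> omega
    rw [Multiset.countP_map] at hcount
    have hcard : (s.filter fun c => f c ≠ 1).card ≤ 1 := hcount
    exact Finset.card_le_one.1 hcard c (Finset.mem_filter.2 ⟨hc, h1⟩) c'
      (Finset.mem_filter.2 ⟨hc', h1'⟩)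
  · intro h
    rcases s.eq_empty_or_nonempty with rfl | ⟨a, ha⟩
    · simp
    right
    -- The first part of the hook is the exceptional one if it exists, and otherwise any part.
    obtain ⟨c, hc, hcs⟩ : ∃ c ∈ s, ∀ c' ∈ s, c' ≠ c → f c' = 1 := by
      by_cases hall : ∃ c ∈ s, f c ≠ 1
      · obtain ⟨c, hc, h1⟩ := hall
        refine ⟨c, hc, fun c' hc' hne => ?_⟩
        by_contra h1'
        exact hne (h c' hc' c hc h1' h1)
      · push Not at hall
        exact ⟨a, ha, fun c' hc' _ => hall c' hc'⟩
    refine ⟨f c, (s.erase c).card, hf c hc, ?_⟩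
    rw [← Multiset.cons_erase (show c ∈ s.val from hc), Multiset.map_cons, ← Finset.erase_val]
    congr 1
    rw [Multiset.eq_replicate]
    refine ⟨by rw [Multiset.card_map]; rfl, fun b hb => ?_⟩
    obtain ⟨c', hc', rfl⟩ := Multiset.mem_map.1 hb
    rw [Finset.mem_val, Finset.mem_erase] at hc'
    exact hcs c' hc'.2 hc'.1

theorem atMostOneLongBalanced_iff_mu {w : B n} :
    AtMostOneLongBalanced w ↔ ((mu w).parts = 0 ∨ IsHook (mu w)) := by
  rw [atMostOneLongBalanced_iff]
  exact (map_val_eq_zero_or_hook_iff _ _ fun _ hc => one_le_of_mem_parts_mu hc).symm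

end Hook

end AbsOrder

theorem theorem5p1 (n : ℕ) (w : AbsOrder.B n) :
    AbsOrder.IsLatticePoset (Set.Icc (1 : AbsOrder.B n) w) ↔
      ((AbsOrder.mu w).parts = 0 ∨ AbsOrder.IsHook (AbsOrder.mu w)) := by
  rw [← AbsOrder.atMostOneLongBalanced_iff_mu]
  constructor
  · intro h
    by_contra hw
    exact AbsOrder.not_isLatticePoset_Icc (AbsOrder.aboveDoubleTwoCycle_of_not hw) h
  · intro h
    exact AbsOrder.isLatticePoset_Icc (AbsOrder.not_aboveDoubleTwoCycle h)
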